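/- **Setting.** Let $m_1,m_2>0$, $E>m_1+m_2$, $E_i(y)=\sqrt{y+m_i^2}$, and $$|\mathbf p_\infty|^2=\frac{(E^2-m_1^2-m_2^2)^2-4m_1^2m_2^2}{4E^2}.$$ Let the conservative potential be the double series $V(|\mathbf p|,r)=\sum_{n,m\ge 0}c_{n,m}(|\mathbf p|)\,(r_1/r)^n(r_2/r)^m$ with $c_{0,0}=0$. Assume that for $(p,\varepsilon_1,\varepsilon_2)$ near $(|\mathbf p_\infty|,0,0)$ the series $\sum c_{n,m}(p)\varepsilon_1^n\varepsilon_2^m$ converges absolutely, and that its sum is a real-analytic function of $(p,\varepsilon_1,\varepsilon_2)$ there. **Classical amplitude.** The $n$-th iteration of the Lippmann–Schwinger equation $\widetilde{\mathcal M}(\mathbf p,\mathbf p')=V(\mathbf p,\mathbf p')+\int_{\mathbf k}V(\mathbf p,\mathbf k)\widetilde{\mathcal M}(\mathbf k,\mathbf p')/(E_p-E_k)$, where $E_k=E_1(\mathbf k^2)+E_2(\mathbf k^2)$ and $V(\mathbf k,\mathbf k')$ is the Fourier transform of the potential with coefficients evaluated at squared momentum $(\mathbf k^2+\mathbf k'^2)/2$,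 has the integrand $\prod_{j=0}^{n}V(\mathbf k_j,\mathbf k_{j+1})\prod_{i=1}^n(E_p-E_{k_i})^{-1}$, with the external momenta on shell, $\mathbf k_0^2=\mathbf k_{n+1}^2=|\mathbf p_\infty|^2$. Put $x_i=\mathbf k_i^2-|\mathbf p_\infty|^2$, so $x_0=x_{n+1}=0$. In the classical limit $x_i=O(\hbar)$, and the integrand is $1/(x_1\cdots x_n)$ times a power series in $x_1,\dots,x_n$. Its classical part consists of the terms of total degree $0$ in the $x_i$ (negative degree is superclassical, positive degree is quantum). It is reduced to a local term by two rules: a numerator factor $x_i$ cancels the propagator $1/x_i$ if that is still present; and if it is already cancelled, the integral over $\mathbf k_i$ is symmetric in the two adjacent momentum transfers, and $x_i$ is replaced by $\tfrac12(x_{i-1}+x_{i+1})$. A term so reduced has no propagator left, and its momentum integrals are convolutions of Fourier transforms of powers of $1/r$, that is, products of potentials at the same $r$ in position space. In formulas, let $K(x)=x/(E_p-E_k)$ at $\mathbf k^2=|\mathbf p_\infty|^2+x$ (continued to $x=0$), and expand $$\prod_{j=0}^{n}V\Big(\sqrt{|\mathbf p_\infty|^2+\tfrac{x_j+x_{j+1}}2},\,r\Big)\prod_{i=1}^nK(x_i)$$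 in powers of the $x_i$; then $\widetilde{\mathcal M}_n(r)=\Phi_n(P_n)$, where $P_n$ is the homogeneous part of degree $n$ and $\Phi_n$ is the linear functional on homogeneous polynomials of degree $n$ with $\Phi_n(x_1\cdots x_n)=1$ and $\Phi_n\big(x_i(2x_i-x_{i-1}-x_{i+1})\,h\big)=0$ for all $i$ and $h$. The classical amplitude is $$\mathcal M_{\rm cl}(|\mathbf p_\infty|,r)=4E_1E_2\sum_{n\ge0}\widetilde{\mathcal M}_n(r),\qquad E_i=E_i(|\mathbf p_\infty|^2).$$ **Statement.** $|\mathbf p_\infty|^2>0$, and there are $\varepsilon,\delta>0$ and a real-analytic function $g$ on $\{|\varepsilon_1|,|\varepsilon_2|<\varepsilon\}$ with $g(0,0)=|\mathbf p_\infty|^2$ such that for all $r>0$ and all $r_1,r_2$ with $|r_1/r|,|r_2/r|<\varepsilon$ the following hold. 1. $|\mathbf p|^2=g(r_1/r,r_2/r)$ is the unique solution, with $\big||\mathbf p|^2-|\mathbf p_\infty|^2\big|<\delta$, of the energy condition $E=E_1(|\mathbf p|^2)+E_2(|\mathbf p|^2)+V(|\mathbf p|,r)$. 2. The series defining $\mathcal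 M_{\rm cl}(|\mathbf p_\infty|,r)$ converges absolutely, and its first terms are, at $|\mathbf p|=|\mathbf p_\infty|$, $$\widetilde{\mathcal M}_0=V,\qquad \widetilde{\mathcal M}_1=-2\frac{E_1E_2}{E}V\,\partial_{|\mathbf p|^2}V-\frac{E_1^2-E_1E_2+E_2^2}{2(E_1^2E_2+E_1E_2^2)}V^2 .$$ 3. $$|\mathbf p|^2=|\mathbf p_\infty|^2-\frac{1}{2E}\,\mathcal M_{\rm cl}(|\mathbf p_\infty|,r).$$ -/

import Mathlib

/-!
Kinematics.  Momenta enter through `y = |p|²` wherever a derivative with respect to `|p|²` occurs.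
-/

/-- Relativistic energy of a particle of mass `m` with squared momentum `y`. -/
noncomputable def particleEnergy (m y : ℝ) : ℝ := Real.sqrt (y + m ^ 2)

/-- Total kinetic energy `E₁ + E₂` in the centre-of-mass frame. -/
noncomputable def kineticEnergy (m₁ m₂ y : ℝ) : ℝ := particleEnergy m₁ y + particleEnergy m₂ y

/-- The squared centre-of-mass momentum `|p_∞|²` at infinite separation. -/
noncomputable def pInfSq (E m₁ m₂ : ℝ) : ℝ :=
  ((E ^ 2 - m₁ ^ 2 - m₂ ^ 2) ^ 2 - 4 * m₁ ^ 2 * m₂ ^ 2) / (4 * E ^ 2)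

/-- The double series `∑ c_{n,m}(p) ε₁ⁿ ε₂ᵐ`. -/
noncomputable def doubleSeries (c : ℕ → ℕ → ℝ → ℝ) (p ε₁ ε₂ : ℝ) : ℝ :=
  ∑' k : ℕ × ℕ, c k.1 k.2 p * ε₁ ^ k.1 * ε₂ ^ k.2

/-- The conservative potential `V(|p|, r) = ∑ c_{n,m}(|p|) (r₁/r)ⁿ (r₂/r)ᵐ`. -/
noncomputable def potential (c : ℕ → ℕ → ℝ → ℝ) (r₁ r₂ p r : ℝ) : ℝ :=
  doubleSeries c p (r₁ / r) (r₂ / r)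

/-!
The classical part of the iterated Lippmann–Schwinger equation.

With external momenta `k₀`, `k_{n+1}` on the energy shell (`k₀² = k_{n+1}² = |p_∞|²`), the `n`-th
iteration of `M = V + ∫_k V(p,k) M(k,p') / (E_p - E_k)` is the integral over `k₁, …, kₙ` of

  `V(k₀,k₁) V(k₁,k₂) ⋯ V(kₙ,k_{n+1}) / ((E_p - E_{k₁}) ⋯ (E_p - E_{kₙ}))`,

where `V(k,k')` is the Fourier transform of the potential whose coefficients `c_{n,m}` are evaluated
at the momentum with square `(k² + k'²)/2`.  Put `xᵢ = kᵢ² - |p_∞|²` (`x₀ = x_{n+1} = 0`).  In the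
classical (soft) limit the momentum transfers, hence the `xᵢ`, scale like `ħ`, and
`1 / (E_p - E_{kᵢ})` has a simple pole at `xᵢ = 0`.  The integrand is therefore a Laurent series in
the `xᵢ`; the terms of total degree `0` are of order `ħ⁰`, those of negative degree are
superclassical (they scale like negative powers of `ħ`), those of positive degree are quantum.
The terms of degree `0` are reduced to local ones as described at `settle`; a local term has no
propagator left, so that its momentum integrals are plain convolutions of the Fourier transforms of
the powers of `1/r`, which in position space is multiplication of the potentials at the same `r`.
-/

/-- Taylor polynomial of degree `n` of `f` at `0`. -/
noncomputable def taylorPoly (f : ℝ → ℝ) (n : ℕ) : Polynomial ℝ :=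
  ∑ k ∈ Finset.range (n + 1),
    Polynomial.C (iteratedDeriv k f 0 / (Nat.factorial k : ℝ)) * Polynomial.X ^ k

/-- The off-shellness `x_j = k_j² - |p_∞|²` of the `j`-th line of a chain with `n` intermediate
lines: a variable for `1 ≤ j ≤ n`, and zero for the two external lines `j = 0`, `j = n + 1`. -/
noncomputable def offShell (n j : ℕ) : MvPolynomial ℕ ℝ :=
  if 1 ≤ j ∧ j ≤ n then MvPolynomial.X j else 0

/-- The propagator `1 / (E_p - E_k)` as a function of `x = k² - y₀`, where `E_p` is the energy at
squared momentum `y₀`, multiplied by `x`; at the removable singularity `x = 0` it has its limit. -/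
noncomputable def reducedPropagator (m₁ m₂ y₀ : ℝ) (x : ℝ) : ℝ :=
  (dslope (fun t => kineticEnergy m₁ m₂ y₀ - kineticEnergy m₁ m₂ (y₀ + t)) 0 x)⁻¹

theorem reducedPropagator_eq (m₁ m₂ y₀ x : ℝ) (hx : x ≠ 0) :
    reducedPropagator m₁ m₂ y₀ x =
      x * (1 / (kineticEnergy m₁ m₂ y₀ - kineticEnergy m₁ m₂ (y₀ + x))) := by
  unfold reducedPropagator
  rw [dslope_of_ne _ hx, slope_def_field]
  simp [div_eq_mul_inv]

/-- The integrand of the `n`-th iteration of the Lippmann–Schwinger equation, times `x₁ ⋯ xₙ`.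
`U y` is the potential at squared momentum `y` (and fixed `r`).  Only the terms of degree at most
`n` matter below, so every factor is replaced by its Taylor polynomial of degree `n`. -/
noncomputable def bornNumerator (m₁ m₂ y₀ : ℝ) (U : ℝ → ℝ) (n : ℕ) : MvPolynomial ℕ ℝ :=
  (∏ j ∈ Finset.range (n + 1),
      Polynomial.aeval (MvPolynomial.C (1 / 2 : ℝ) * (offShell n j + offShell n (j + 1)))
        (taylorPoly (fun x => U (y₀ + x)) n)) *
    ∏ i ∈ Finset.Icc 1 n,
      Polynomial.aeval (offShell n i) (taylorPoly (reducedPropagator m₁ m₂ y₀) n)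

/-- Reduction of a numerator `x_{i₁} x_{i₂} ⋯` (given as a list of indices) over `x₁ ⋯ xₙ` to a
local term.  `S` is the set of the lines whose propagator is already cancelled.
* A factor `xᵢ` with `i ∉ S` cancels the propagator `1/xᵢ`.
* A line `i ∈ S` has no propagator any more, and the integral over `kᵢ` is, in the classical limit,
  symmetric under the exchange `kᵢ ↦ k_{i-1} + k_{i+1} - kᵢ` of the two adjacent momentum transfers,
  so that a factor `xᵢ` is integrated to the mean of `x_{i-1}` and `x_{i+1}`.  On a run of such
  lines between the nearest lines `a < i < b` outside `S`, these relations say that `xᵢ` is the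
  linear interpolation `((b - i) x_a + (i - a) x_b) / (b - a)`.
* The external lines `0` and `n + 1` are on shell: `x₀ = x_{n+1} = 0`.
For `n` factors the result is a number (every propagator is cancelled in the end), and it does not
depend on the order of the factors. -/
noncomputable def settle (n : ℕ) : List ℕ → Finset ℕ → ℝ
  | [], _ => 1
  | i :: l, S =>
      if i ∈ S then
        let a : ℕ := sSup {j : ℕ | j < i ∧ j ∉ S}
        let b : ℕ := sInf {j : ℕ | i < j ∧ j ∉ S}
        (if a = 0 then 0 else ((b : ℝ) - i) / ((b : ℝ) - a) * settle n l (insert a S)) +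
          (if b = n + 1 then 0 else ((i : ℝ) - a) / ((b : ℝ) - a) * settle n l (insert b S))
      else settle n l (insert i S)

/-- The classical part of `P / (x₁ ⋯ xₙ)`: the terms of degree `0`, reduced to local ones. -/
noncomputable def classicalPart (n : ℕ) (P : MvPolynomial ℕ ℝ) : ℝ :=
  ∑ e ∈ (MvPolynomial.homogeneousComponent n P).support,
    P.coeff e * settle n ((Finsupp.toMultiset e).sort (· ≤ ·)) ∅

/-- Classical part, in position space, of the `n`-th iteration of the Lippmann–Schwinger equation
for the potential `V(|p|, r)`, at on-shell squared momentum `y₀` and non-relativistically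
normalised, that is, the `n`-th term of `M_cl / (4 E₁ E₂)`. -/
noncomputable def classicalBornTerm (m₁ m₂ y₀ : ℝ) (c : ℕ → ℕ → ℝ → ℝ) (r₁ r₂ r : ℝ) (n : ℕ) : ℝ :=
  classicalPart n (bornNumerator m₁ m₂ y₀ (fun y => potential c r₁ r₂ (Real.sqrt y) r) n)

/-- The classical amplitude `M_cl(|p|, r)` with relativistic normalisation, `|p|² = y₀`. -/
noncomputable def classicalAmplitude (m₁ m₂ y₀ : ℝ) (c : ℕ → ℕ → ℝ → ℝ) (r₁ r₂ r : ℝ) : ℝ :=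
  4 * particleEnergy m₁ y₀ * particleEnergy m₂ y₀ *
    ∑' n : ℕ, classicalBornTerm m₁ m₂ y₀ c r₁ r₂ r n

/-- The energy condition `E = E₁ + E₂ + V` for the squared momentum `y ≥ 0`. -/
def EnergyCondition (E m₁ m₂ : ℝ) (c : ℕ → ℕ → ℝ → ℝ) (r₁ r₂ r y : ℝ) : Prop :=
  0 ≤ y ∧ E = particleEnergy m₁ y + particleEnergy m₂ y + potential c r₁ r₂ (Real.sqrt y) r

/-- One step of the reduction: the factor `x_i` is absorbed into the state `S` of cancelled lines,
and the outcome is weighed by `φ`. -/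
noncomputable def hop (n : ℕ) (φ : Finset ℕ → ℝ) (S : Finset ℕ) (i : ℕ) : ℝ :=
  if i ∈ Finset.Icc 1 n then
    if i ∈ S then
      let a : ℕ := sSup {j : ℕ | j < i ∧ j ∉ S}
      let b : ℕ := sInf {j : ℕ | i < j ∧ j ∉ S}
      (if a = 0 then 0 else ((b : ℝ) - i) / ((b : ℝ) - a) * φ (insert a S)) +
        (if b = n + 1 then 0 else ((i : ℝ) - a) / ((b : ℝ) - a) * φ (insert b S))
    else φ (insert i S)
  else 0

/-- `a` and `b` are the nearest points outside `S` on the two sides of `i ∈ S`. -/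
def IsGap (S : Finset ℕ) (i a b : ℕ) : Prop :=
  a < i ∧ i < b ∧ a ∉ S ∧ b ∉ S ∧ ∀ j, a < j → j < b → j ∈ S

theorem IsGap.sSup_eq {S : Finset ℕ} {i a b : ℕ} (h : IsGap S i a b) :
    sSup {j : ℕ | j < i ∧ j ∉ S} = a := by
  obtain ⟨h1, h2, h3, h4, h5⟩ := h
  apply IsGreatest.csSup_eq
  refine ⟨⟨h1, h3⟩, fun j hj => ?_⟩
  by_contra hlt
  exact hj.2 (h5 j (not_le.mp hlt) (hj.1.trans h2))

theorem IsGap.sInf_eq {S : Finset ℕ} {i a b : ℕ} (h : IsGap S i a b) :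
    sInf {j : ℕ | i < j ∧ j ∉ S} = b := by
  obtain ⟨h1, h2, h3, h4, h5⟩ := h
  apply IsLeast.csInf_eq
  refine ⟨⟨h2, h4⟩, fun j hj => ?_⟩
  by_contra hlt
  exact hj.2 (h5 j (h1.trans hj.1) (not_le.mp hlt))

theorem exists_isGap {n : ℕ} {S : Finset ℕ} (hS : S ⊆ Finset.Icc 1 n) {i : ℕ} (hi : i ∈ S) :
    ∃ a b, IsGap S i a b := by
  have h0 : (0 : ℕ) ∉ S := fun h => by simpa using hS h
  have hn : n + 1 ∉ S := fun h => by simpa using hS h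
  have hi' := Finset.mem_Icc.mp (hS hi)
  have hA : ({j : ℕ | j < i ∧ j ∉ S}).Nonempty := ⟨0, by omega, h0⟩
  have hAb : BddAbove {j : ℕ | j < i ∧ j ∉ S} :=
    ⟨i, fun _ hj => le_of_lt hj.1⟩
  have hB : ({j : ℕ | i < j ∧ j ∉ S}).Nonempty := ⟨n + 1, by omega, hn⟩
  refine ⟨sSup {j : ℕ | j < i ∧ j ∉ S}, sInf {j : ℕ | i < j ∧ j ∉ S}, (Nat.sSup_mem hA hAb).1,
    (Nat.sInf_mem hB).1, (Nat.sSup_mem hA hAb).2, (Nat.sInf_mem hB).2, fun j h1 h2 => ?_⟩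
  by_contra hj
  rcases lt_trichotomy j i with h | h | h
  · exact absurd (le_csSup hAb ⟨h, hj⟩) (not_le.mpr h1)
  · exact hj (h ▸ hi)
  · exact absurd (Nat.sInf_le (s := {j : ℕ | i < j ∧ j ∉ S}) ⟨h, hj⟩) (not_le.mpr h2)

theorem hop_of_notMem_Icc {n : ℕ} {φ : Finset ℕ → ℝ} {S : Finset ℕ} {i : ℕ}
    (hi : i ∉ Finset.Icc 1 n) : hop n φ S i = 0 := by
  simp only [hop, if_neg hi]

theorem hop_of_notMem {n : ℕ} {φ : Finset ℕ → ℝ} {S : Finset ℕ} {i : ℕ}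
    (hi : i ∈ Finset.Icc 1 n) (hS : i ∉ S) : hop n φ S i = φ (insert i S) := by
  simp only [hop, if_pos hi, if_neg hS]

theorem IsGap.hop_eq {n : ℕ} {φ : Finset ℕ → ℝ} {S : Finset ℕ} (hS : S ⊆ Finset.Icc 1 n)
    {i a b : ℕ} (h : IsGap S i a b) :
    hop n φ S i = ((b : ℝ) - i) / ((b : ℝ) - a) * hop n φ S a +
      ((i : ℝ) - a) / ((b : ℝ) - a) * hop n φ S b := by
  have h' := h
  obtain ⟨h1, h2, h3, h4, h5⟩ := h
  have hi : i ∈ S := h5 i h1 h2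
  have hin := Finset.mem_Icc.mp (hS hi)
  have hb : b ≤ n + 1 := by
    have := Finset.mem_Icc.mp (hS (h5 (b - 1) (by omega) (by omega)))
    omega
  have ha : hop n φ S a = if a = 0 then 0 else φ (insert a S) := by
    split_ifs with h0
    · exact hop_of_notMem_Icc (by simp [h0])
    · exact hop_of_notMem (Finset.mem_Icc.mpr (by omega)) h3
  have hb' : hop n φ S b = if b = n + 1 then 0 else φ (insert b S) := by
    split_ifs with h0
    · exact hop_of_notMem_Icc (by simp [h0])
    · exact hop_of_notMem (Finset.mem_Icc.mpr (by omega)) h4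
  rw [ha, hb']
  simp only [hop, if_pos (hS hi), if_pos hi, h'.sSup_eq, h'.sInf_eq, mul_ite, mul_zero]

theorem IsGap.of_mem {S : Finset ℕ} {i a b j : ℕ} (h : IsGap S i a b) (h1 : a < j) (h2 : j < b) :
    IsGap S j a b := ⟨h1, h2, h.2.2⟩

/-- `u` extends the boundary values `φ (insert i S)`, `i ∉ S`, harmonically to `S`. -/
structure IsHarmonicExt (n : ℕ) (φ : Finset ℕ → ℝ) (S : Finset ℕ) (u : ℕ → ℝ) : Prop where
  harmonic : ∀ i ∈ S, 2 * u i = u (i - 1) + u (i + 1)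
  boundary : ∀ i ∈ Finset.Icc 1 n, i ∉ S → u i = φ (insert i S)
  zero : ∀ i, i ∉ Finset.Icc 1 n → u i = 0

theorem hop_interpolate {n : ℕ} {φ : Finset ℕ → ℝ} {S : Finset ℕ} (hS : S ⊆ Finset.Icc 1 n)
    {i a b j : ℕ} (h : IsGap S i a b) (h1 : a ≤ j) (h2 : j ≤ b) :
    hop n φ S j = ((b : ℝ) - j) / ((b : ℝ) - a) * hop n φ S a +
      ((j : ℝ) - a) / ((b : ℝ) - a) * hop n φ S b := by
  have hab : (b : ℝ) - a ≠ 0 := by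
    have : (a : ℝ) < b := by exact_mod_cast h.1.trans h.2.1
    linarith
  rcases h1.eq_or_lt with rfl | h1
  · simp [div_self hab]
  rcases h2.eq_or_lt with rfl | h2
  · simp [div_self hab]
  exact (h.of_mem h1 h2).hop_eq hS

theorem hop_isHarmonicExt {n : ℕ} (φ : Finset ℕ → ℝ) {S : Finset ℕ} (hS : S ⊆ Finset.Icc 1 n) :
    IsHarmonicExt n φ S (hop n φ S) where
  harmonic i hi := by
    obtain ⟨a, b, h⟩ := exists_isGap hS hi
    have h1 := h.1
    have h2 := h.2.1
    rw [hop_interpolate hS h (j := i) (by omega) (by omega),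
      hop_interpolate hS h (j := i - 1) (by omega) (by omega),
      hop_interpolate hS h (j := i + 1) (by omega) (by omega)]
    push_cast [show 1 ≤ i by omega]
    ring
  boundary i h1 h2 := hop_of_notMem h1 h2
  zero i h := hop_of_notMem_Icc h

theorem nonpos_of_harmonic {n : ℕ} {S : Finset ℕ} (hS : S ⊆ Finset.Icc 1 n) {u : ℕ → ℝ}
    (h1 : ∀ i ∈ S, 2 * u i = u (i - 1) + u (i + 1)) (h2 : ∀ i, i ∉ S → u i = 0) (i : ℕ) :
    u i ≤ 0 := by
  by_cases hi : i ∈ S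
  swap
  · exact (h2 i hi).le
  obtain ⟨m, hm, hmax⟩ := S.exists_max_image u ⟨i, hi⟩
  by_contra hpos
  have hmpos : 0 < u m := (not_le.mp hpos).trans_le (hmax i hi)
  have hall : ∀ j, u j ≤ u m := fun j => by
    by_cases hj : j ∈ S
    · exact hmax j hj
    · rw [h2 j hj]; exact hmpos.le
  have hstep : ∀ k, m + k ∈ S ∧ u (m + k) = u m := by
    intro k
    induction k with
    | zero => exact ⟨hm, rfl⟩
    | succ k ih =>
      have e := h1 _ ih.1
      have e1 := hall (m + k - 1)
      have e2 := hall (m + k + 1)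
      have e3 : u (m + (k + 1)) = u m := by
        rw [← add_assoc]; linarith [ih.2]
      refine ⟨?_, e3⟩
      by_contra hne
      rw [h2 _ hne] at e3
      linarith
  have := Finset.mem_Icc.mp (hS (hstep (n + 1)).1)
  omega

theorem eq_zero_of_harmonic {n : ℕ} {S : Finset ℕ} (hS : S ⊆ Finset.Icc 1 n) {u : ℕ → ℝ}
    (h1 : ∀ i ∈ S, 2 * u i = u (i - 1) + u (i + 1)) (h2 : ∀ i, i ∉ S → u i = 0) (i : ℕ) :
    u i = 0 := by
  refine le_antisymm (nonpos_of_harmonic hS h1 h2 i) ?_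
  have := nonpos_of_harmonic hS (u := fun i => -u i)
    (fun i hi => by linarith [h1 i hi]) (fun i hi => by simp [h2 i hi]) i
  linarith

theorem IsHarmonicExt.eq_hop {n : ℕ} {φ : Finset ℕ → ℝ} {S : Finset ℕ} {u : ℕ → ℝ}
    (h : IsHarmonicExt n φ S u) (hS : S ⊆ Finset.Icc 1 n) (i : ℕ) : u i = hop n φ S i := by
  have h' := hop_isHarmonicExt φ hS
  refine sub_eq_zero.mp (eq_zero_of_harmonic hS (u := fun i => u i - hop n φ S i) ?_ ?_ i)
  · intro i hi
    linarith [h.harmonic i hi, h'.harmonic i hi]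
  · intro i hi
    by_cases hn : i ∈ Finset.Icc 1 n
    · simp only [h.boundary i hn hi, h'.boundary i hn hi, sub_self]
    · simp only [h.zero i hn, h'.zero i hn, sub_self]

theorem hop_congr {n : ℕ} {φ ψ : Finset ℕ → ℝ} {S : Finset ℕ} (hS : S ⊆ Finset.Icc 1 n)
    (h : ∀ x ∈ Finset.Icc 1 n, x ∉ S → φ (insert x S) = ψ (insert x S)) (i : ℕ) :
    hop n φ S i = hop n ψ S i := by
  have h' := hop_isHarmonicExt φ hS
  refine IsHarmonicExt.eq_hop ⟨h'.harmonic, fun i hi hi' => ?_, h'.zero⟩ hS i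
  rw [h'.boundary i hi hi', h i hi hi']

theorem hop_sum {n : ℕ} {ι : Type*} (s : Finset ι) (c : ι → ℝ) (φ : ι → Finset ℕ → ℝ)
    {S : Finset ℕ} (hS : S ⊆ Finset.Icc 1 n) (i : ℕ) :
    hop n (fun T => ∑ k ∈ s, c k * φ k T) S i = ∑ k ∈ s, c k * hop n (φ k) S i := by
  symm
  refine IsHarmonicExt.eq_hop (u := fun i => ∑ k ∈ s, c k * hop n (φ k) S i) ⟨?_, ?_, ?_⟩ hS i
  · intro i hi
    rw [Finset.mul_sum, ← Finset.sum_add_distrib]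
    refine Finset.sum_congr rfl fun k _ => ?_
    linear_combination c k * (hop_isHarmonicExt (φ k) hS).harmonic i hi
  · intro i hi hi'
    exact Finset.sum_congr rfl fun k _ => by rw [hop_of_notMem hi hi']
  · intro i hi
    exact Finset.sum_eq_zero fun k _ => by rw [hop_of_notMem_Icc hi, mul_zero]

theorem hop_comm {n : ℕ} (φ : Finset ℕ → ℝ) {S : Finset ℕ} (hS : S ⊆ Finset.Icc 1 n) (i j : ℕ) :
    hop n (fun T => hop n φ T j) S i = hop n (fun T => hop n φ T i) S j := by
  have hins : ∀ x ∈ Finset.Icc 1 n, insert x S ⊆ Finset.Icc 1 n := fun x hx =>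
    Finset.insert_subset hx hS
  symm
  refine IsHarmonicExt.eq_hop (φ := fun T => hop n φ T j)
    (u := fun i => hop n (fun T => hop n φ T i) S j) ⟨?_, ?_, ?_⟩ hS i
  · intro i hi
    have h1 := hop_sum (n := n) (Finset.univ : Finset (Fin 2)) (fun _ => 1 / 2)
      (fun k T => hop n φ T (if k = 0 then i - 1 else i + 1)) hS j
    rw [hop_congr (φ := fun T => hop n φ T i) hS (fun x hx _ => ?_) j, h1]
    · simp [Fin.sum_univ_two]
      ring
    · have := (hop_isHarmonicExt φ (hins x hx)).harmonic i (Finset.mem_insert_of_mem hi)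
      simp [Fin.sum_univ_two]
      linarith
  · intro i hi hi'
    symm
    refine IsHarmonicExt.eq_hop (φ := fun T => hop n φ T i)
      (u := fun j => hop n φ (insert i S) j) ⟨?_, ?_, ?_⟩ hS j
    · intro j hj
      exact (hop_isHarmonicExt φ (hins i hi)).harmonic j (Finset.mem_insert_of_mem hj)
    · intro j hj hj'
      by_cases hij : i = j
      · rw [hij]
      · rw [hop_of_notMem hj (by simp [hj', Ne.symm hij]), hop_of_notMem hi (by simp [hi', hij]),
          Finset.insert_comm]
    · intro j hj
      exact hop_of_notMem_Icc hj
  · intro i hi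
    rw [hop_congr (ψ := fun T => ∑ k ∈ (∅ : Finset ℕ), (0 : ℝ) * φ T) hS
      (fun x _ _ => by simp [hop_of_notMem_Icc hi]), hop_sum ∅ (fun _ => 0) (fun _ => φ) hS]
    simp

/-- Reduction of a list of factors, with the final state weighed by `φ`. -/
noncomputable def run (n : ℕ) (l : List ℕ) (φ : Finset ℕ → ℝ) : Finset ℕ → ℝ :=
  l.foldr (fun i ψ S => hop n ψ S i) φ

theorem run_nil (n : ℕ) (φ : Finset ℕ → ℝ) : run n [] φ = φ := rfl

theorem run_cons (n i : ℕ) (l : List ℕ) (φ : Finset ℕ → ℝ) (S : Finset ℕ) :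
    run n (i :: l) φ S = hop n (run n l φ) S i := rfl

theorem run_append (n : ℕ) (l l' : List ℕ) (φ : Finset ℕ → ℝ) :
    run n (l ++ l') φ = run n l (run n l' φ) := by
  simp only [run, List.foldr_append]

theorem run_congr {n : ℕ} {φ ψ : Finset ℕ → ℝ} (h : ∀ S ⊆ Finset.Icc 1 n, φ S = ψ S)
    (l : List ℕ) : ∀ S ⊆ Finset.Icc 1 n, run n l φ S = run n l ψ S := by
  induction l with
  | nil => exact h
  | cons i l ih =>
    intro S hS
    exact hop_congr hS (fun x hx _ => ih _ (Finset.insert_subset hx hS)) i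

theorem run_perm {n : ℕ} {l l' : List ℕ} (h : l.Perm l') (φ : Finset ℕ → ℝ) :
    ∀ S ⊆ Finset.Icc 1 n, run n l φ S = run n l' φ S := by
  induction h with
  | nil => exact fun _ _ => rfl
  | cons i _ ih =>
    exact fun S hS => hop_congr hS (fun x hx _ => ih _ (Finset.insert_subset hx hS)) i
  | swap i j l => exact fun S hS => hop_comm _ hS _ _
  | trans _ _ ih1 ih2 => exact fun S hS => (ih1 S hS).trans (ih2 S hS)

theorem run_sum {n : ℕ} {ι : Type*} (s : Finset ι) (c : ι → ℝ) (φ : ι → Finset ℕ → ℝ)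
    (l : List ℕ) : ∀ S ⊆ Finset.Icc 1 n,
    run n l (fun T => ∑ k ∈ s, c k * φ k T) S = ∑ k ∈ s, c k * run n l (φ k) S := by
  induction l with
  | nil => exact fun _ _ => rfl
  | cons i l ih =>
    intro S hS
    simp only [run_cons]
    rw [← hop_sum s c _ hS]
    exact hop_congr hS (fun x hx _ => ih _ (Finset.insert_subset hx hS)) i

theorem run_eq_zero_of_mem {n : ℕ} {l : List ℕ} {i : ℕ} (hl : i ∈ l) (hi : i ∉ Finset.Icc 1 n)
    (φ : Finset ℕ → ℝ) {S : Finset ℕ} (hS : S ⊆ Finset.Icc 1 n) : run n l φ S = 0 := by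
  obtain ⟨l', hl'⟩ : ∃ l', l.Perm (i :: l') := ⟨_, List.perm_cons_erase hl⟩
  rw [run_perm hl' φ S hS, run_cons, hop_of_notMem_Icc hi]

theorem hop_zero {n : ℕ} {φ : Finset ℕ → ℝ} {S : Finset ℕ} (hS : S ⊆ Finset.Icc 1 n)
    (h : ∀ x ∈ Finset.Icc 1 n, x ∉ S → φ (insert x S) = 0) (i : ℕ) : hop n φ S i = 0 := by
  symm
  exact IsHarmonicExt.eq_hop (u := fun _ => 0)
    ⟨by simp, fun i hi hi' => (h i hi hi').symm, fun _ _ => rfl⟩ hS i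

/-- Every step adds one line to the state. -/
theorem run_eq_zero_of_card {n d : ℕ} {φ : Finset ℕ → ℝ}
    (h : ∀ S ⊆ Finset.Icc 1 n, S.card ≠ d → φ S = 0) (l : List ℕ) :
    ∀ S ⊆ Finset.Icc 1 n, S.card + l.length ≠ d → run n l φ S = 0 := by
  induction l with
  | nil => exact h
  | cons i l ih =>
    intro S hS hd
    refine hop_zero hS (fun x hx hx' => ih _ (Finset.insert_subset hx hS) ?_) i
    rw [Finset.card_insert_of_notMem hx']
    simp only [List.length_cons] at hd
    omega

theorem run_congr_of_card {n d : ℕ} {φ ψ : Finset ℕ → ℝ}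
    (h : ∀ S ⊆ Finset.Icc 1 n, S.card = d → φ S = ψ S) (l : List ℕ) :
    ∀ S ⊆ Finset.Icc 1 n, S.card + l.length = d → run n l φ S = run n l ψ S := by
  induction l with
  | nil => exact h
  | cons i l ih =>
    intro S hS hd
    refine hop_congr hS (fun x hx hx' => ih _ (Finset.insert_subset hx hS) ?_) i
    rw [Finset.card_insert_of_notMem hx']
    simp only [List.length_cons] at hd
    omega

/-- The weight that selects the state `T`. -/
noncomputable def stateIndicator (T S : Finset ℕ) : ℝ := if S = T then 1 else 0

theorem settle_eq_run_one {n : ℕ} (l : List ℕ) (hl : ∀ i ∈ l, i ∈ Finset.Icc 1 n) (S : Finset ℕ) :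
    settle n l S = run n l (fun _ => 1) S := by
  induction l generalizing S with
  | nil => rfl
  | cons i l ih =>
    have ih' : ∀ S, settle n l S = run n l (fun _ => 1) S :=
      ih fun i hi => hl i (List.mem_cons_of_mem _ hi)
    simp only [settle, run_cons, hop, if_pos (hl i List.mem_cons_self), ih']

theorem settle_eq_run {n : ℕ} (l : List ℕ) (hl : ∀ i ∈ l, i ∈ Finset.Icc 1 n)
    (hn : l.length = n) :
    settle n l ∅ = run n l (stateIndicator (Finset.Icc 1 n)) ∅ := by
  rw [settle_eq_run_one l hl]
  refine run_congr_of_card (d := n) (fun S hS hd => ?_) l ∅ (Finset.empty_subset _) (by simp [hn])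
  rw [stateIndicator, if_pos (Finset.eq_of_subset_of_card_le hS (by simp [hd]))]

theorem run_full_eq_zero {n : ℕ} (l : List ℕ) (hn : l.length ≠ n) :
    run n l (stateIndicator (Finset.Icc 1 n)) ∅ = 0 := by
  refine run_eq_zero_of_card (d := n) (fun S _ hd => ?_) l ∅ (Finset.empty_subset _) (by simpa)
  rw [stateIndicator, if_neg]
  rintro rfl
  simp at hd

/-- The probability that the random walk from `j` reaches `k` before `0` and `n + 1`. -/
noncomputable def hittingWeight (n k j : ℕ) : ℝ :=
  if j ≤ k then (j : ℝ) / k else ((n + 1 - j : ℕ) : ℝ) / ((n + 1 - k : ℕ) : ℝ)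

theorem hittingWeight_isHarmonicExt {n k : ℕ} (hk : k ∈ Finset.Icc 1 n) :
    IsHarmonicExt n (stateIndicator (Finset.Icc 1 n)) ((Finset.Icc 1 n).erase k)
      (hittingWeight n k) where
  harmonic i hi := by
    simp only [Finset.mem_erase, Finset.mem_Icc] at hi hk
    rcases lt_or_gt_of_ne hi.1 with h | h
    · simp only [hittingWeight, if_pos (show i ≤ k by omega), if_pos (show i - 1 ≤ k by omega),
        if_pos (show i + 1 ≤ k by omega)]
      push_cast [show 1 ≤ i by omega]
      ring
    · have hk1 : ((n + 1 - k : ℕ) : ℝ) ≠ 0 := by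
        rw [Nat.cast_ne_zero]; omega
      have hi1 : hittingWeight n k (i - 1) =
          ((n + 1 - (i - 1) : ℕ) : ℝ) / ((n + 1 - k : ℕ) : ℝ) := by
        rw [hittingWeight]
        split_ifs with h'
        · obtain rfl : i - 1 = k := by omega
          rw [div_self hk1, div_self]
          rw [Nat.cast_ne_zero]; omega
        · rfl
      rw [hi1]
      simp only [hittingWeight, if_neg (show ¬ i ≤ k by omega), if_neg (show ¬ i + 1 ≤ k by omega)]
      rw [← add_div, ← mul_div_assoc]
      congr 1
      norm_cast
      omega
  boundary i hi hi' := by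
    obtain rfl : i = k := by
      by_contra h
      exact hi' (Finset.mem_erase.mpr ⟨h, hi⟩)
    have : (i : ℝ) ≠ 0 := by
      rw [Nat.cast_ne_zero]; simp at hk; omega
    rw [Finset.insert_erase hi, stateIndicator, if_pos rfl, hittingWeight, if_pos le_rfl,
      div_self this]
  zero i hi := by
    simp only [Finset.mem_Icc, not_and, not_le] at hi hk
    rw [hittingWeight]
    split_ifs with h
    · obtain rfl : i = 0 := by
        by_contra h0
        have := hi (by omega)
        omega
      simp
    · rw [Nat.sub_eq_zero_of_le (by omega)]
      simp

/-- The last factor of a numerator fills the single line that is left. -/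
theorem hop_full {n : ℕ} {S : Finset ℕ} (hS : S ⊆ Finset.Icc 1 n) (j : ℕ) :
    hop n (stateIndicator (Finset.Icc 1 n)) S j =
      ∑ k ∈ Finset.Icc 1 n, hittingWeight n k j * stateIndicator ((Finset.Icc 1 n).erase k) S := by
  by_cases h : ∃ k ∈ Finset.Icc 1 n, S = (Finset.Icc 1 n).erase k
  · obtain ⟨k, hk, rfl⟩ := h
    rw [← (hittingWeight_isHarmonicExt hk).eq_hop hS, Finset.sum_eq_single k]
    · simp [stateIndicator]
    · intro l hl hlk
      rw [stateIndicator, if_neg, mul_zero]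
      intro h
      have : l ∈ (Finset.Icc 1 n).erase k := Finset.mem_erase.mpr ⟨hlk, hl⟩
      rw [h] at this
      simp at this
    · exact fun h => absurd hk h
  · rw [Finset.sum_eq_zero fun k hk => ?_, hop_zero hS fun x hx hx' => ?_]
    · rw [stateIndicator, if_neg]
      intro h'
      exact h ⟨x, hx, by rw [← h', Finset.erase_insert hx']⟩
    · rw [stateIndicator, if_neg fun h' => h ⟨k, hk, h'⟩, mul_zero]

theorem run_concat_full {n : ℕ} (l : List ℕ) (j : ℕ) :
    run n (l ++ [j]) (stateIndicator (Finset.Icc 1 n)) ∅ =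
      ∑ k ∈ Finset.Icc 1 n,
        hittingWeight n k j * run n l (stateIndicator ((Finset.Icc 1 n).erase k)) ∅ := by
  rw [run_append, ← run_sum _ _ _ _ _ (Finset.empty_subset _)]
  exact run_congr (fun S hS => hop_full hS j) l ∅ (Finset.empty_subset _)

theorem run_vanish {n k : ℕ} {φ : Finset ℕ → ℝ} (h : ∀ S ⊆ Finset.Icc 1 n, k ∈ S → φ S = 0)
    (l : List ℕ) : ∀ S ⊆ Finset.Icc 1 n, k ∈ S → run n l φ S = 0 := by
  induction l with
  | nil => exact h
  | cons i l ih =>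
    intro S hS hk
    exact hop_zero hS (fun x hx _ => ih _ (Finset.insert_subset hx hS)
      (Finset.mem_insert_of_mem hk)) i

theorem run_erase_eq_zero {n k : ℕ} {l : List ℕ} (hk : k ∈ l) :
    run n l (stateIndicator ((Finset.Icc 1 n).erase k)) ∅ = 0 := by
  by_cases hk' : k ∈ Finset.Icc 1 n
  swap
  · exact run_eq_zero_of_mem hk hk' _ (Finset.empty_subset _)
  obtain ⟨l', hl'⟩ : ∃ l', l.Perm (k :: l') := ⟨_, List.perm_cons_erase hk⟩
  rw [run_perm hl' _ _ (Finset.empty_subset _), run_cons,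
    hop_of_notMem hk' (Finset.notMem_empty k)]
  refine run_vanish (fun S _ hkS => ?_) l' _ (Finset.insert_subset hk' (Finset.empty_subset _))
    (Finset.mem_insert_self _ _)
  rw [stateIndicator, if_neg]
  rintro rfl
  simp at hkS

theorem image_rev_subset {n : ℕ} {S : Finset ℕ} (hS : S ⊆ Finset.Icc 1 n) :
    S.image (n + 1 - ·) ⊆ Finset.Icc 1 n := by
  intro i hi
  obtain ⟨j, hj, rfl⟩ := Finset.mem_image.mp hi
  have := Finset.mem_Icc.mp (hS hj)
  exact Finset.mem_Icc.mpr (by omega)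

theorem mem_image_rev {n : ℕ} {S : Finset ℕ} (hS : S ⊆ Finset.Icc 1 n) {i : ℕ} (hi : i ≤ n + 1) :
    n + 1 - i ∈ S.image (n + 1 - ·) ↔ i ∈ S := by
  constructor
  · intro h
    obtain ⟨j, hj, hji⟩ := Finset.mem_image.mp h
    have := Finset.mem_Icc.mp (hS hj)
    obtain rfl : j = i := by omega
    exact hj
  · exact fun h => Finset.mem_image_of_mem _ h

theorem hop_rev {n : ℕ} (φ : Finset ℕ → ℝ) {S : Finset ℕ} (hS : S ⊆ Finset.Icc 1 n) (i : ℕ) :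
    hop n φ (S.image (n + 1 - ·)) (n + 1 - i) = hop n (fun T => φ (T.image (n + 1 - ·))) S i := by
  have hS' := image_rev_subset hS
  refine IsHarmonicExt.eq_hop (u := fun i => hop n φ (S.image (n + 1 - ·)) (n + 1 - i))
    ⟨?_, ?_, ?_⟩ hS i
  · intro i hi
    have hin := Finset.mem_Icc.mp (hS hi)
    have := (hop_isHarmonicExt φ hS').harmonic (n + 1 - i) (Finset.mem_image_of_mem _ hi)
    rw [show n + 1 - (i - 1) = n + 1 - i + 1 by omega, show n + 1 - (i + 1) = n + 1 - i - 1 by omega]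
    linarith
  · intro i hi hi'
    have hin := Finset.mem_Icc.mp hi
    rw [hop_of_notMem (Finset.mem_Icc.mpr (by omega))
      (fun h => hi' ((mem_image_rev hS (by omega)).mp h)), Finset.image_insert]
  · intro i hi
    refine hop_of_notMem_Icc fun h => hi ?_
    rw [Finset.mem_Icc] at h ⊢
    omega

theorem run_rev {n : ℕ} (l : List ℕ) (φ : Finset ℕ → ℝ) : ∀ S ⊆ Finset.Icc 1 n,
    run n (l.map (n + 1 - ·)) φ (S.image (n + 1 - ·)) =
      run n l (fun T => φ (T.image (n + 1 - ·))) S := by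
  induction l with
  | nil => exact fun _ _ => rfl
  | cons i l ih =>
    intro S hS
    simp only [List.map_cons, run_cons]
    rw [hop_rev _ hS]
    exact hop_congr hS (fun x hx _ => ih _ (Finset.insert_subset hx hS)) i

theorem run_rev_full {n : ℕ} (l : List ℕ) :
    run n (l.map (n + 1 - ·)) (stateIndicator (Finset.Icc 1 n)) ∅ =
      run n l (stateIndicator (Finset.Icc 1 n)) ∅ := by
  have h := run_rev (n := n) l (stateIndicator (Finset.Icc 1 n)) ∅ (Finset.empty_subset _)
  rw [Finset.image_empty] at h
  rw [h]
  refine run_congr (fun S hS => ?_) l ∅ (Finset.empty_subset _)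
  have key : S.image (n + 1 - ·) = Finset.Icc 1 n ↔ S = Finset.Icc 1 n := by
    constructor
    · intro h
      refine Finset.Subset.antisymm hS fun i hi => ?_
      have hi' := Finset.mem_Icc.mp hi
      rw [← mem_image_rev hS (by omega), h, Finset.mem_Icc]
      omega
    · rintro rfl
      refine Finset.Subset.antisymm (image_rev_subset hS) fun i hi => ?_
      have hi' := Finset.mem_Icc.mp hi
      exact Finset.mem_image.mpr ⟨n + 1 - i, Finset.mem_Icc.mpr (by omega), by omega⟩
  simp only [stateIndicator, key]

/-- The union of a state on the left and a state on the right of the line `a + 1`. -/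
def glue (a : ℕ) (L R : Finset ℕ) : Finset ℕ := L ∪ R.image (· + (a + 1))

theorem mem_glue_left {a : ℕ} {L R : Finset ℕ} {i : ℕ} (hi : i ≤ a) : i ∈ glue a L R ↔ i ∈ L := by
  simp only [glue, Finset.mem_union, Finset.mem_image]
  constructor
  · rintro (h | ⟨j, _, rfl⟩)
    · exact h
    · omega
  · exact Or.inl

theorem mem_glue_right {a : ℕ} {L R : Finset ℕ} (hL : L ⊆ Finset.Icc 1 a) {i : ℕ} :
    i + (a + 1) ∈ glue a L R ↔ i ∈ R := by
  simp only [glue, Finset.mem_union, Finset.mem_image]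
  constructor
  · rintro (h | ⟨j, hj, hji⟩)
    · have := Finset.mem_Icc.mp (hL h)
      omega
    · obtain rfl : j = i := by omega
      exact hj
  · exact fun h => Or.inr ⟨i, h, rfl⟩

theorem notMem_glue {a b : ℕ} {L R : Finset ℕ} (hL : L ⊆ Finset.Icc 1 a)
    (hR : R ⊆ Finset.Icc 1 b) : a + 1 ∉ glue a L R := by
  intro h
  rw [show a + 1 = 0 + (a + 1) by omega, mem_glue_right hL] at h
  simpa using hR h

theorem glue_subset {a b : ℕ} {L R : Finset ℕ} (hL : L ⊆ Finset.Icc 1 a)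
    (hR : R ⊆ Finset.Icc 1 b) : glue a L R ⊆ Finset.Icc 1 (a + b + 1) := by
  intro i hi
  simp only [glue, Finset.mem_union, Finset.mem_image] at hi
  rcases hi with h | ⟨j, hj, rfl⟩
  · have := Finset.mem_Icc.mp (hL h)
    exact Finset.mem_Icc.mpr (by omega)
  · have := Finset.mem_Icc.mp (hR hj)
    exact Finset.mem_Icc.mpr (by omega)

theorem insert_glue_left (a i : ℕ) (L R : Finset ℕ) :
    insert i (glue a L R) = glue a (insert i L) R := by
  simp only [glue, Finset.insert_union]

theorem insert_glue_right (a i : ℕ) (L R : Finset ℕ) :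
    insert (i + (a + 1)) (glue a L R) = glue a L (insert i R) := by
  simp only [glue, Finset.image_insert, Finset.union_insert]

section Split

variable {a b : ℕ} {φ ψ χ : Finset ℕ → ℝ}

theorem hop_glue_left (h0 : ∀ S ⊆ Finset.Icc 1 (a + b + 1), a + 1 ∈ S → φ S = 0)
    (h : ∀ L ⊆ Finset.Icc 1 a, ∀ R ⊆ Finset.Icc 1 b, φ (glue a L R) = ψ L * χ R)
    {L R : Finset ℕ} (hL : L ⊆ Finset.Icc 1 a) (hR : R ⊆ Finset.Icc 1 b) {i : ℕ} (hi : i ≤ a) :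
    hop (a + b + 1) φ (glue a L R) i = hop a ψ L i * χ R := by
  have hS := glue_subset hL hR
  have H := hop_isHarmonicExt φ hS
  have HL := hop_isHarmonicExt ψ hL
  have hmid : a + 1 ∈ Finset.Icc 1 (a + b + 1) := Finset.mem_Icc.mpr (by omega)
  have hmid0 : hop (a + b + 1) φ (glue a L R) (a + 1) = 0 := by
    rw [hop_of_notMem hmid (notMem_glue hL hR)]
    exact h0 _ (Finset.insert_subset hmid hS) (Finset.mem_insert_self _ _)
  have hmidL : hop a ψ L (a + 1) = 0 := hop_of_notMem_Icc (by simp)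
  have key := IsHarmonicExt.eq_hop (φ := φ) (S := glue a L R) (n := a + b + 1)
    (u := fun i => if i ≤ a then hop a ψ L i * χ R else hop (a + b + 1) φ (glue a L R) i)
    ⟨?_, ?_, ?_⟩ hS i
  · simpa only [if_pos hi] using key.symm
  · intro i hi
    have hi1 := Finset.mem_Icc.mp (hS hi)
    have hne : i ≠ a + 1 := fun h => notMem_glue hL hR (h ▸ hi)
    rcases lt_or_ge a i with hlt | hle
    · have e : (if i - 1 ≤ a then hop a ψ L (i - 1) * χ R
          else hop (a + b + 1) φ (glue a L R) (i - 1)) =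
          hop (a + b + 1) φ (glue a L R) (i - 1) := if_neg (by omega)
      simp only [e, if_neg (show ¬ i ≤ a by omega), if_neg (show ¬ i + 1 ≤ a by omega)]
      exact H.harmonic i hi
    · have e : (if i + 1 ≤ a then hop a ψ L (i + 1) * χ R
          else hop (a + b + 1) φ (glue a L R) (i + 1)) = hop a ψ L (i + 1) * χ R := by
        split_ifs with h'
        · rfl
        · obtain rfl : i = a := by omega
          rw [hmid0, hmidL, zero_mul]
      simp only [e, if_pos hle, if_pos (show i - 1 ≤ a by omega)]
      linear_combination χ R * HL.harmonic i ((mem_glue_left hle).mp hi)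
  · intro i hi hi'
    by_cases hle : i ≤ a
    · have hia : i ∈ Finset.Icc 1 a := Finset.mem_Icc.mpr ⟨(Finset.mem_Icc.mp hi).1, hle⟩
      simp only [if_pos hle]
      rw [insert_glue_left, h _ (Finset.insert_subset hia hL) _ hR,
        hop_of_notMem hia (fun h => hi' ((mem_glue_left hle).mpr h))]
    · simp only [if_neg hle]
      exact H.boundary i hi hi'
  · intro i hi
    split_ifs with hle
    · rw [hop_of_notMem_Icc, zero_mul]
      simp only [Finset.mem_Icc] at hi ⊢
      omega
    · exact H.zero i hi

theorem hop_glue_right (h0 : ∀ S ⊆ Finset.Icc 1 (a + b + 1), a + 1 ∈ S → φ S = 0)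
    (h : ∀ L ⊆ Finset.Icc 1 a, ∀ R ⊆ Finset.Icc 1 b, φ (glue a L R) = ψ L * χ R)
    {L R : Finset ℕ} (hL : L ⊆ Finset.Icc 1 a) (hR : R ⊆ Finset.Icc 1 b) (i : ℕ) :
    hop (a + b + 1) φ (glue a L R) (i + (a + 1)) = ψ L * hop b χ R i := by
  have hS := glue_subset hL hR
  have H := hop_isHarmonicExt φ hS
  have hmid : a + 1 ∈ Finset.Icc 1 (a + b + 1) := Finset.mem_Icc.mpr (by omega)
  have key : hop (a + b + 1) φ (glue a L R) (i + (a + 1)) =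
      hop b (fun T => ∑ _k ∈ ({0} : Finset ℕ), ψ L * χ T) R i := by
    refine IsHarmonicExt.eq_hop (u := fun i => hop (a + b + 1) φ (glue a L R) (i + (a + 1)))
      ⟨?_, ?_, ?_⟩ hR i
    · intro i hi
      have hi1 := Finset.mem_Icc.mp (hR hi)
      have := H.harmonic (i + (a + 1)) ((mem_glue_right hL).mpr hi)
      rwa [show i + (a + 1) - 1 = i - 1 + (a + 1) by omega,
        show i + (a + 1) + 1 = i + 1 + (a + 1) by omega] at this
    · intro i hi hi'
      have hi1 := Finset.mem_Icc.mp hi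
      rw [hop_of_notMem (Finset.mem_Icc.mpr (by omega)) (fun h => hi' ((mem_glue_right hL).mp h)),
        insert_glue_right, h _ hL _ (Finset.insert_subset hi hR), Finset.sum_singleton]
    · intro i hi
      rcases Nat.eq_zero_or_pos i with rfl | hpos
      · rw [zero_add, hop_of_notMem hmid (notMem_glue hL hR)]
        exact h0 _ (Finset.insert_subset hmid hS) (Finset.mem_insert_self _ _)
      · refine hop_of_notMem_Icc fun h' => hi ?_
        rw [Finset.mem_Icc] at h' ⊢
        omega
  rw [key, hop_sum _ (fun _ => ψ L) (fun _ => χ) hR, Finset.sum_singleton]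

theorem run_glue (h0 : ∀ S ⊆ Finset.Icc 1 (a + b + 1), a + 1 ∈ S → φ S = 0)
    (h : ∀ L ⊆ Finset.Icc 1 a, ∀ R ⊆ Finset.Icc 1 b, φ (glue a L R) = ψ L * χ R)
    (l l' : List ℕ) (hl : ∀ i ∈ l, i ≤ a) : ∀ L ⊆ Finset.Icc 1 a, ∀ R ⊆ Finset.Icc 1 b,
    run (a + b + 1) (l ++ l'.map (· + (a + 1))) φ (glue a L R) = run a l ψ L * run b l' χ R := by
  induction l with
  | nil =>
    rw [List.nil_append, run_nil]
    induction l' with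
    | nil => exact h
    | cons i l' ih =>
      intro L hL R hR
      rw [List.map_cons, run_cons, run_cons]
      exact hop_glue_right (run_vanish h0 _) ih hL hR i
  | cons i l ih =>
    intro L hL R hR
    rw [List.cons_append, run_cons, run_cons]
    exact hop_glue_left (run_vanish h0 _) (ih fun i hi => hl i (List.mem_cons_of_mem _ hi)) hL hR
      (hl i List.mem_cons_self)

end Split

theorem glue_eq_erase_iff {a b : ℕ} {L R : Finset ℕ} (hL : L ⊆ Finset.Icc 1 a)
    (hR : R ⊆ Finset.Icc 1 b) : glue a L R = (Finset.Icc 1 (a + b + 1)).erase (a + 1) ↔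
      L = Finset.Icc 1 a ∧ R = Finset.Icc 1 b := by
  constructor
  · intro h
    refine ⟨Finset.Subset.antisymm hL fun i hi => ?_, Finset.Subset.antisymm hR fun i hi => ?_⟩
    · have hi' := Finset.mem_Icc.mp hi
      rw [← mem_glue_left (R := R) hi'.2, h, Finset.mem_erase, Finset.mem_Icc]
      omega
    · have hi' := Finset.mem_Icc.mp hi
      rw [← mem_glue_right hL, h, Finset.mem_erase, Finset.mem_Icc]
      omega
  · rintro ⟨rfl, rfl⟩
    ext i
    rw [Finset.mem_erase, Finset.mem_Icc]
    rcases le_or_gt i a with hi | hi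
    · rw [mem_glue_left hi, Finset.mem_Icc]
      omega
    · obtain ⟨j, rfl⟩ : ∃ j, i = j + (a + 1) := ⟨i - (a + 1), by omega⟩
      rw [mem_glue_right hL, Finset.mem_Icc]
      omega

/-- Lists of factors on the two sides of the line `a + 1` are reduced independently as long as
the propagator of that line is not cancelled. -/
theorem run_split (a b : ℕ) (l l' : List ℕ) (hl : ∀ i ∈ l, i ≤ a) :
    run (a + b + 1) (l ++ l'.map (· + (a + 1)))
        (stateIndicator ((Finset.Icc 1 (a + b + 1)).erase (a + 1))) ∅ =
      run a l (stateIndicator (Finset.Icc 1 a)) ∅ *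
        run b l' (stateIndicator (Finset.Icc 1 b)) ∅ := by
  have h := run_glue (b := b) (φ := stateIndicator ((Finset.Icc 1 (a + b + 1)).erase (a + 1)))
    (ψ := stateIndicator (Finset.Icc 1 a)) (χ := stateIndicator (Finset.Icc 1 b)) ?_ ?_ l l' hl
    ∅ (Finset.empty_subset _) ∅ (Finset.empty_subset _)
  · simpa [glue] using h
  · intro S _ hS
    rw [stateIndicator, if_neg]
    rintro rfl
    simp at hS
  · intro L hL R hR
    simp only [stateIndicator, glue_eq_erase_iff hL hR, ite_and, mul_ite, mul_one, mul_zero]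
    split_ifs <;> rfl

section Functional

open MvPolynomial

variable {R : Type*} [CommRing R]

variable (R) in
/-- Restriction to the variables in `s`. -/
noncomputable def restrictVars (s : Set ℕ) [DecidablePred (· ∈ s)] :
    MvPolynomial ℕ R →ₐ[R] MvPolynomial ℕ R :=
  aeval fun i => if i ∈ s then X i else 0

theorem restrictVars_X (s : Set ℕ) [DecidablePred (· ∈ s)] (i : ℕ) :
    restrictVars R s (X i) = if i ∈ s then X i else 0 := aeval_X _ _

theorem restrictVars_monomial (s : Set ℕ) [DecidablePred (· ∈ s)] (e : ℕ →₀ ℕ) (c : R)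
    [Decidable (∀ i ∈ e.support, i ∈ s)] :
    restrictVars R s (monomial e c) = if ∀ i ∈ e.support, i ∈ s then monomial e c else 0 := by
  rw [restrictVars, aeval_monomial, algebraMap_eq]
  split_ifs with h
  · rw [monomial_eq]
    congr 1
    exact Finsupp.prod_congr fun i hi => by rw [if_pos (h i hi)]
  · push Not at h
    obtain ⟨i, hi, his⟩ := h
    rw [Finsupp.prod, Finset.prod_eq_zero hi, mul_zero]
    rw [if_neg his, zero_pow (Finsupp.mem_support_iff.mp hi)]

variable [Algebra ℝ R]

/-- The total weight of a monomial numerator, with the final state weighed by `φ`. -/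
noncomputable def monomialWeight (n : ℕ) (φ : Finset ℕ → ℝ) (e : ℕ →₀ ℕ) : ℝ :=
  run n ((Finsupp.toMultiset e).sort (· ≤ ·)) φ ∅

theorem monomialWeight_eq_run {n : ℕ} (φ : Finset ℕ → ℝ) {e : ℕ →₀ ℕ} {l : List ℕ}
    (h : (l : Multiset ℕ) = Finsupp.toMultiset e) : monomialWeight n φ e = run n l φ ∅ := by
  refine run_perm ?_ φ ∅ (Finset.empty_subset _)
  rw [← Multiset.coe_eq_coe, Multiset.sort_eq, h]

variable (R) in
/-- The linear functional on numerators given by `monomialWeight`. -/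
noncomputable def numeratorFunctional (n : ℕ) (φ : Finset ℕ → ℝ) : MvPolynomial ℕ R →ₗ[R] R :=
  (basisMonomials ℕ R).constr R fun e => algebraMap ℝ R (monomialWeight n φ e)

theorem numeratorFunctional_monomial (n : ℕ) (φ : Finset ℕ → ℝ) (e : ℕ →₀ ℕ) (c : R) :
    numeratorFunctional R n φ (monomial e c) = c * algebraMap ℝ R (monomialWeight n φ e) := by
  have h : monomial e c = c • basisMonomials ℕ R e := by
    rw [coe_basisMonomials, smul_monomial, smul_eq_mul, mul_one]
  rw [h, map_smul, numeratorFunctional, Module.Basis.constr_basis, smul_eq_mul]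

variable (R) in
/-- The functional of the classical part. -/
noncomputable abbrev localFunctional (n : ℕ) : MvPolynomial ℕ R →ₗ[R] R :=
  numeratorFunctional R n (stateIndicator (Finset.Icc 1 n))

variable (R) in
/-- The functional that keeps the propagator of the line `k` uncancelled. -/
noncomputable abbrev cutFunctional (n k : ℕ) : MvPolynomial ℕ R →ₗ[R] R :=
  numeratorFunctional R n (stateIndicator ((Finset.Icc 1 n).erase k))

theorem monomialWeight_single_add (n : ℕ) (j : ℕ) (e : ℕ →₀ ℕ) :
    monomialWeight n (stateIndicator (Finset.Icc 1 n)) (Finsupp.single j 1 + e) =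
      ∑ k ∈ Finset.Icc 1 n, hittingWeight n k j *
        monomialWeight n (stateIndicator ((Finset.Icc 1 n).erase k)) e := by
  rw [monomialWeight_eq_run (l := (Finsupp.toMultiset e).sort (· ≤ ·) ++ [j]), run_concat_full]
  · rfl
  · rw [← Multiset.coe_add, Multiset.sort_eq, map_add, Finsupp.toMultiset_single, one_smul,
      Multiset.coe_singleton, add_comm]

theorem localFunctional_X_mul (n j : ℕ) (h : MvPolynomial ℕ R) :
    localFunctional R n (X j * h) = ∑ k ∈ Finset.Icc 1 n,
      algebraMap ℝ R (hittingWeight n k j) * cutFunctional R n k h := by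
  induction h using MvPolynomial.induction_on' with
  | monomial e c =>
    rw [X, monomial_mul, numeratorFunctional_monomial, monomialWeight_single_add, one_mul, map_sum,
      Finset.mul_sum]
    refine Finset.sum_congr rfl fun k _ => ?_
    rw [numeratorFunctional_monomial, map_mul]
    ring
  | add p q hp hq =>
    rw [mul_add, map_add, hp, hq, ← Finset.sum_add_distrib]
    refine Finset.sum_congr rfl fun k _ => ?_
    rw [map_add, mul_add]

theorem mem_toMultiset_sort {e : ℕ →₀ ℕ} {i : ℕ} :
    i ∈ (Finsupp.toMultiset e).sort (· ≤ ·) ↔ i ∈ e.support := by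
  rw [Multiset.mem_sort, Finsupp.mem_toMultiset]

theorem cutFunctional_restrictVars (n k : ℕ) (h : MvPolynomial ℕ R) :
    cutFunctional R n k (restrictVars R {i | i ≠ k} h) = cutFunctional R n k h := by
  classical
  induction h using MvPolynomial.induction_on' with
  | monomial e c =>
    rw [restrictVars_monomial]
    split_ifs with h
    · rfl
    · push Not at h
      obtain ⟨i, hi, hik⟩ := h
      obtain rfl : i = k := by simpa using hik
      rw [map_zero, numeratorFunctional_monomial, monomialWeight,
        run_erase_eq_zero (mem_toMultiset_sort.mpr hi), map_zero, mul_zero]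
  | add p q hp hq => rw [map_add, map_add, map_add, hp, hq]

theorem localFunctional_monomial_eq_zero {n : ℕ} {e : ℕ →₀ ℕ} {i : ℕ} (hi : i ∈ e.support)
    (hn : i ∉ Finset.Icc 1 n) (c : R) : localFunctional R n (monomial e c) = 0 := by
  rw [numeratorFunctional_monomial, monomialWeight,
    run_eq_zero_of_mem (mem_toMultiset_sort.mpr hi) hn _ (Finset.empty_subset _), map_zero,
    mul_zero]

theorem localFunctional_restrictVars (n : ℕ) (h : MvPolynomial ℕ R) :
    localFunctional R n (restrictVars R {i | i ∈ Finset.Icc 1 n} h) = localFunctional R n h := by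
  classical
  induction h using MvPolynomial.induction_on' with
  | monomial e c =>
    rw [restrictVars_monomial]
    split_ifs with h
    · rfl
    · push Not at h
      obtain ⟨i, hi, hik⟩ := h
      rw [map_zero, localFunctional_monomial_eq_zero hi hik]
  | add p q hp hq => rw [map_add, map_add, map_add, hp, hq]

theorem cutFunctional_split (a b : ℕ) (A B : MvPolynomial ℕ R)
    (hA : restrictVars R {i | i ∈ Finset.Icc 1 a} A = A) :
    cutFunctional R (a + b + 1) (a + 1) (A * rename (· + (a + 1)) B) =
      localFunctional R a A * localFunctional R b B := by
  classical
  rw [← localFunctional_restrictVars a A]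
  nth_rewrite 1 [← hA]
  clear hA
  induction A using MvPolynomial.induction_on' with
  | add p q hp hq => rw [map_add, add_mul, map_add, hp, hq, map_add, add_mul]
  | monomial e c =>
    rw [restrictVars_monomial]
    split_ifs with h
    swap
    · rw [zero_mul, map_zero, map_zero, zero_mul]
    induction B using MvPolynomial.induction_on' with
    | add p q hp hq => rw [map_add, mul_add, map_add, hp, hq, map_add, mul_add]
    | monomial f d =>
      rw [rename_monomial, monomial_mul, numeratorFunctional_monomial,
        numeratorFunctional_monomial, numeratorFunctional_monomial,
        monomialWeight_eq_run (l := (Finsupp.toMultiset e).sort (· ≤ ·) ++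
          ((Finsupp.toMultiset f).sort (· ≤ ·)).map (· + (a + 1))), run_split, map_mul]
      · simp only [monomialWeight]
        ring
      · intro i hi
        have := h i (mem_toMultiset_sort.mp hi)
        exact (Finset.mem_Icc.mp this).2
      · rw [← Multiset.coe_add, ← Multiset.map_coe, Multiset.sort_eq, Multiset.sort_eq, map_add,
          Finsupp.toMultiset_map]

theorem localFunctional_rename_rev (n : ℕ) (h : MvPolynomial ℕ R) :
    localFunctional R n (rename (n + 1 - ·) h) = localFunctional R n h := by
  induction h using MvPolynomial.induction_on' with
  | monomial e c =>
    rw [rename_monomial, numeratorFunctional_monomial, numeratorFunctional_monomial,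
      monomialWeight_eq_run (l := ((Finsupp.toMultiset e).sort (· ≤ ·)).map (n + 1 - ·)),
      run_rev_full]
    · rfl
    · rw [← Multiset.map_coe, Multiset.sort_eq, Finsupp.toMultiset_map]
  | add p q hp hq => rw [map_add, map_add, map_add, hp, hq]

/-- Euler's identity for the local part, which only sees the terms of degree `n`. -/
theorem localFunctional_euler (n : ℕ) (h : MvPolynomial ℕ R) :
    localFunctional R n (∑ j ∈ Finset.Icc 1 n, X j * pderiv j h) =
      (n : R) * localFunctional R n h := by
  induction h using MvPolynomial.induction_on' with
  | monomial e c =>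
    simp only [X_mul_pderiv_monomial]
    rw [← Finset.sum_smul, map_nsmul, nsmul_eq_mul]
    by_cases hs : ∀ i ∈ e.support, i ∈ Finset.Icc 1 n
    · by_cases hd : ∑ j ∈ Finset.Icc 1 n, e j = n
      · rw [hd]
      · have : localFunctional R n (monomial e c) = 0 := by
          rw [numeratorFunctional_monomial, monomialWeight, run_full_eq_zero, map_zero, mul_zero]
          rw [Multiset.length_sort, Finsupp.card_toMultiset, Finsupp.sum,
            Finset.sum_subset (fun i hi => hs i hi)]
          · exact hd
          · intro i _ hi
            exact Finsupp.notMem_support_iff.mp hi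
        rw [this, mul_zero, mul_zero]
    · push Not at hs
      obtain ⟨i, hi, hin⟩ := hs
      rw [localFunctional_monomial_eq_zero hi hin, mul_zero, mul_zero]
  | add p q hp hq =>
    simp only [map_add, mul_add, Finset.sum_add_distrib] at hp hq ⊢
    rw [hp, hq]

/-- The additive map `d`, applied to the coefficients. -/
noncomputable def mapCoeffs (d : R →ₗ[ℝ] R) (p : MvPolynomial ℕ R) : MvPolynomial ℕ R :=
  ∑ e ∈ p.support, monomial e (d (coeff e p))

theorem coeff_mapCoeffs (d : R →ₗ[ℝ] R) (p : MvPolynomial ℕ R) (e : ℕ →₀ ℕ) :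
    coeff e (mapCoeffs d p) = d (coeff e p) := by
  classical
  rw [mapCoeffs, coeff_sum]
  simp only [coeff_monomial]
  rw [Finset.sum_ite_eq' p.support e]
  split_ifs with h
  · rfl
  · rw [notMem_support_iff.mp h, map_zero]

/-- The derivation that acts on the coefficients. -/
noncomputable def coeffDerivation (d : Derivation ℝ R R) :
    Derivation ℝ (MvPolynomial ℕ R) (MvPolynomial ℕ R) :=
  Derivation.mk'
    { toFun := mapCoeffs d
      map_add' := fun p q => by
        ext e
        rw [coeff_add, coeff_mapCoeffs, coeff_mapCoeffs, coeff_mapCoeffs, coeff_add, map_add]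
      map_smul' := fun c p => by
        ext e
        rw [RingHom.id_apply, coeff_smul, coeff_mapCoeffs, coeff_mapCoeffs, coeff_smul, map_smul] }
    (fun p q => by
      classical
      ext e
      rw [LinearMap.coe_mk, AddHom.coe_mk, smul_eq_mul, smul_eq_mul, mul_comm q]
      simp only [coeff_add, coeff_mapCoeffs, coeff_mul, map_sum, Derivation.coeFn_coe,
        Derivation.leibniz, smul_eq_mul]
      rw [← Finset.sum_add_distrib]
      exact Finset.sum_congr rfl fun x _ => by ring)

theorem coeff_coeffDerivation (d : Derivation ℝ R R) (p : MvPolynomial ℕ R) (e : ℕ →₀ ℕ) :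
    coeff e (coeffDerivation d p) = d (coeff e p) := coeff_mapCoeffs _ _ _

theorem coeffDerivation_monomial (d : Derivation ℝ R R) (e : ℕ →₀ ℕ) (c : R) :
    coeffDerivation d (monomial e c) = monomial e (d c) := by
  classical
  ext f
  rw [coeff_coeffDerivation, coeff_monomial, coeff_monomial]
  split_ifs
  · rfl
  · rw [map_zero]

theorem numeratorFunctional_coeffDerivation (d : Derivation ℝ R R) (n : ℕ) (φ : Finset ℕ → ℝ)
    (p : MvPolynomial ℕ R) :
    numeratorFunctional R n φ (coeffDerivation d p) = d (numeratorFunctional R n φ p) := by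
  induction p using MvPolynomial.induction_on' with
  | monomial e c =>
    rw [coeffDerivation_monomial, numeratorFunctional_monomial, numeratorFunctional_monomial,
      Derivation.leibniz, Derivation.map_algebraMap, smul_zero, zero_add, smul_eq_mul, mul_comm]
  | add p q hp hq => rw [map_add, map_add, map_add, map_add, hp, hq]

theorem localFunctional_map {R' : Type*} [CommRing R'] [Algebra ℝ R'] (f : R →ₐ[ℝ] R') (n : ℕ)
    (p : MvPolynomial ℕ R) :
    localFunctional R' n (map (f : R →+* R') p) = f (localFunctional R n p) := by
  induction p using MvPolynomial.induction_on' with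
  | monomial e c =>
    rw [map_monomial, numeratorFunctional_monomial, numeratorFunctional_monomial, map_mul,
      AlgHom.commutes]
    rfl
  | add p q hp hq => rw [map_add, map_add, map_add, map_add, hp, hq]

theorem classicalPart_eq_localFunctional (n : ℕ) (P : MvPolynomial ℕ ℝ)
    (hP : restrictVars ℝ {i | i ∈ Finset.Icc 1 n} P = P) :
    classicalPart n P = localFunctional ℝ n P := by
  classical
  have hsupp : ∀ e ∈ P.support, ∀ i ∈ e.support, i ∈ Finset.Icc 1 n := by
    intro e he
    by_contra hcon
    refine mem_support_iff.mp he ?_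
    rw [← hP]
    clear hP he
    induction P using MvPolynomial.induction_on' with
    | monomial f c =>
      rw [restrictVars_monomial]
      split_ifs with h
      · rw [coeff_monomial, if_neg]
        rintro rfl
        exact hcon h
      · exact coeff_zero _
    | add p q hp hq => rw [map_add, coeff_add, hp, hq, add_zero]
  have h1 : localFunctional ℝ n P = ∑ e ∈ P.support,
      P.coeff e * monomialWeight n (stateIndicator (Finset.Icc 1 n)) e := by
    nth_rewrite 1 [P.as_sum]
    rw [map_sum]
    exact Finset.sum_congr rfl fun e _ => numeratorFunctional_monomial _ _ _ _
  rw [h1, classicalPart]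
  have hhom : ∀ e, e ∈ (homogeneousComponent n P).support ↔ e.degree = n ∧ e ∈ P.support := by
    intro e
    rw [mem_support_iff, mem_support_iff, coeff_homogeneousComponent]
    split_ifs with h <;> simp [h]
  rw [← Finset.sum_subset (s₁ := (homogeneousComponent n P).support)
    (fun e he => ((hhom e).mp he).2)]
  · refine Finset.sum_congr rfl fun e he => ?_
    obtain ⟨hd, hs⟩ := (hhom e).mp he
    rw [settle_eq_run, monomialWeight]
    · exact fun i hi => hsupp e hs i (mem_toMultiset_sort.mp hi)
    · rw [Multiset.length_sort, Finsupp.card_toMultiset, ← hd, Finsupp.degree]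
      rfl
  · intro e he hne
    rw [monomialWeight, run_full_eq_zero, mul_zero]
    rw [Multiset.length_sort, Finsupp.card_toMultiset]
    intro hd
    exact hne ((hhom e).mpr ⟨hd, he⟩)

end Functional

section Chain

open MvPolynomial

/-- The product of the vertices `V((z_j + z_{j+1})/2)` and the reduced propagators `K(z_i)` along a
chain with `m` intermediate lines. -/
noncomputable def chain {B : Type*} [CommRing B] [Algebra ℝ B] (V K : Polynomial ℝ) (m : ℕ)
    (z : ℕ → B) : B :=
  (∏ j ∈ Finset.range (m + 1),
      Polynomial.aeval (algebraMap ℝ B (1 / 2) * (z j + z (j + 1))) V) *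
    ∏ i ∈ Finset.Icc 1 m, Polynomial.aeval (z i) K

variable {B : Type*} [CommRing B] [Algebra ℝ B] {B' : Type*} [CommRing B'] [Algebra ℝ B']
  (V K : Polynomial ℝ)

theorem chain_congr {m : ℕ} {z z' : ℕ → B} (h : ∀ j ≤ m + 1, z j = z' j) :
    chain V K m z = chain V K m z' := by
  unfold chain
  congr 1
  · refine Finset.prod_congr rfl fun j hj => ?_
    have := Finset.mem_range.mp hj
    rw [h j (by omega), h (j + 1) (by omega)]
  · refine Finset.prod_congr rfl fun j hj => ?_
    have := Finset.mem_Icc.mp hj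
    rw [h j (by omega)]

theorem map_chain (f : B →ₐ[ℝ] B') (m : ℕ) (z : ℕ → B) :
    f (chain V K m z) = chain V K m fun j => f (z j) := by
  simp only [chain, map_mul, map_prod, ← Polynomial.aeval_algHom_apply, map_add, AlgHom.commutes]

@[to_additive sum_Icc_one]
theorem prod_Icc_one {M : Type*} [CommMonoid M] (m : ℕ) (f : ℕ → M) :
    ∏ i ∈ Finset.Icc 1 m, f i = ∏ i ∈ Finset.range m, f (i + 1) := by
  induction m with
  | zero => simp
  | succ m ih => rw [Finset.prod_Icc_succ_top (by omega), Finset.prod_range_succ, ih]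

theorem chain_split (a b : ℕ) (z : ℕ → B) :
    chain V K (a + b + 1) z = chain V K a z * Polynomial.aeval (z (a + 1)) K *
      chain V K b (fun j => z (j + (a + 1))) := by
  simp only [chain, prod_Icc_one]
  rw [show a + b + 1 + 1 = a + 1 + (b + 1) by ring, Finset.prod_range_add,
    show a + b + 1 = a + 1 + b by ring, Finset.prod_range_add _ (a + 1) b,
    Finset.prod_range_succ (fun i => Polynomial.aeval (z (i + 1)) K) a]
  have h1 : ∀ x, a + 1 + x = x + (a + 1) := fun x => by ring
  have h2 : ∀ x, x + 1 + (a + 1) = x + (a + 1) + 1 := fun x => by ring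
  simp only [h1, h2]
  ring

theorem chain_rev (m : ℕ) (z : ℕ → B) :
    chain V K m (fun j => z (m + 1 - j)) = chain V K m z := by
  unfold chain
  congr 1
  · rw [← Finset.prod_range_reflect]
    refine Finset.prod_congr rfl fun j hj => ?_
    have := Finset.mem_range.mp hj
    simp only [show m + 1 - (m + 1 - 1 - j) = j + 1 by omega,
      show m + 1 - (m + 1 - 1 - j + 1) = j by omega, add_comm (z (j + 1))]
  · rw [prod_Icc_one, prod_Icc_one, ← Finset.prod_range_reflect]
    refine Finset.prod_congr rfl fun j hj => ?_
    have := Finset.mem_range.mp hj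
    simp only [show m + 1 - (m - 1 - j + 1) = j + 1 by omega]

/-- The chain in independent variables. -/
noncomputable def chainPoly (m : ℕ) : MvPolynomial (Fin (m + 2)) ℝ :=
  chain V K m fun j => if h : j < m + 2 then X ⟨j, h⟩ else 0

theorem chain_eq_aeval (m : ℕ) (z : ℕ → B) :
    chain V K m z = aeval (fun j : Fin (m + 2) => z j) (chainPoly V K m) := by
  rw [chainPoly, map_chain]
  refine chain_congr V K fun j hj => ?_
  rw [dif_pos (by omega), aeval_X]

/-- The derivative of the chain at `z` in the direction `w`. -/
noncomputable def chainGrad (m : ℕ) (z w : ℕ → B) : B :=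
  ∑ j : Fin (m + 2), aeval (fun j : Fin (m + 2) => z j) (pderiv j (chainPoly V K m)) * w j

theorem Derivation.map_mvPolynomial_aeval {ι : Type*} [Fintype ι] (d : Derivation ℝ B B) (z : ι → B)
    (U : MvPolynomial ι ℝ) :
    d (aeval z U) = ∑ j, aeval z (pderiv j U) * d (z j) := by
  classical
  induction U using MvPolynomial.induction_on with
  | C c => simp
  | add p q hp hq => simp only [map_add, hp, hq, add_mul, Finset.sum_add_distrib]
  | mul_X p i hp =>
    simp only [map_mul, aeval_X, Derivation.leibniz, hp, pderiv_X, smul_eq_mul, map_add, add_mul,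
      Finset.sum_add_distrib, Finset.mul_sum]
    congr 1
    · rw [Finset.sum_eq_single i]
      · simp
      · intro j _ hj
        simp [hj.symm]
      · simp
    · exact Finset.sum_congr rfl fun j _ => by ring

theorem Derivation.map_chain (d : Derivation ℝ B B) (m : ℕ) (z : ℕ → B) :
    d (chain V K m z) = chainGrad V K m z fun j => d (z j) := by
  rw [chain_eq_aeval, d.map_mvPolynomial_aeval, chainGrad]

theorem chainGrad_congr {m : ℕ} {z z' w w' : ℕ → B} (h : ∀ j ≤ m + 1, z j = z' j)
    (h' : ∀ j ≤ m + 1, w j = w' j) : chainGrad V K m z w = chainGrad V K m z' w' := by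
  unfold chainGrad
  have : (fun j : Fin (m + 2) => z j) = fun j : Fin (m + 2) => z' j :=
    funext fun j => h j (by omega)
  rw [this]
  exact Finset.sum_congr rfl fun j _ => by rw [h' j (by omega)]

theorem map_chainGrad (f : B →ₐ[ℝ] B') (m : ℕ) (z w : ℕ → B) :
    f (chainGrad V K m z w) = chainGrad V K m (fun j => f (z j)) fun j => f (w j) := by
  simp only [chainGrad, map_sum, map_mul, ← comp_aeval_apply]

theorem chainGrad_add (m : ℕ) (z w w' : ℕ → B) :
    chainGrad V K m z w + chainGrad V K m z w' = chainGrad V K m z fun j => w j + w' j := by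
  simp only [chainGrad, mul_add, Finset.sum_add_distrib]

theorem rename_rev_chainPoly (m : ℕ) :
    rename Fin.rev (chainPoly V K m) = chainPoly V K m := by
  rw [chainPoly, _root_.map_chain]
  conv_rhs => rw [← chain_rev]
  refine chain_congr V K fun j hj => ?_
  rw [dif_pos (by omega), dif_pos (by omega), rename_X]
  congr 1
  ext
  simp only [Fin.val_rev]
  omega

theorem chainGrad_rev (m : ℕ) (z w : ℕ → B) :
    chainGrad V K m (fun j => z (m + 1 - j)) (fun j => w (m + 1 - j)) = chainGrad V K m z w := by
  unfold chainGrad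
  have hr : ∀ j : Fin (m + 2), m + 1 - (j : ℕ) = Fin.rev j := fun j => by
    simp only [Fin.val_rev]
    omega
  simp only [hr]
  rw [← Equiv.sum_comp Fin.revPerm]
  refine Finset.sum_congr rfl fun j _ => ?_
  rw [Fin.revPerm_apply, Fin.rev_rev]
  congr 1
  rw [← rename_rev_chainPoly, pderiv_rename Fin.rev_injective, aeval_rename, rename_rev_chainPoly]
  congr 2
  funext i
  exact congrArg z (by simp only [Fin.val_rev]; omega)

end Chain

section Recursion

open MvPolynomial

local notation "𝓡" => Polynomial ℝ
local notation "𝓜" => MvPolynomial ℕ (Polynomial ℝ)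

/-- The off-shellness of the lines of a chain, shifted by a common amount. -/
noncomputable def shiftedOffShell (n j : ℕ) : 𝓜 :=
  C Polynomial.X + if 1 ≤ j ∧ j ≤ n then X j else 0

variable (V K : Polynomial ℝ)

/-- The local part of the chain with vertices `V` and reduced propagators `K`, as a function of a
common shift of all lines. -/
noncomputable def bornPoly (n : ℕ) : 𝓡 :=
  localFunctional 𝓡 n (chain V K n (shiftedOffShell n))

theorem algebraMap_eq_C_C (c : ℝ) : algebraMap ℝ 𝓜 c = C (Polynomial.C c) := rfl

theorem localFunctional_chainGrad_rev (n : ℕ) (α : ℕ → ℝ) :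
    localFunctional 𝓡 n (chainGrad V K n (shiftedOffShell n) fun j => algebraMap ℝ 𝓜 (α j)) =
      localFunctional 𝓡 n
        (chainGrad V K n (shiftedOffShell n) fun j => algebraMap ℝ 𝓜 (α (n + 1 - j))) := by
  rw [← localFunctional_rename_rev,
    ← AlgHom.restrictScalars_apply ℝ (rename (R := 𝓡) (n + 1 - ·)), map_chainGrad,
    ← chainGrad_rev]
  refine congrArg _ (chainGrad_congr V K (fun j hj => ?_) (fun j hj => ?_))
  · simp only [AlgHom.restrictScalars_apply, shiftedOffShell, map_add, rename_C]
    congr 1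
    split_ifs with h1 h2 h2
    · rw [rename_X]
      congr 1
      omega
    · omega
    · omega
    · exact map_zero _
  · exact AlgHom.commutes _ _

theorem localFunctional_chainGrad_half (n : ℕ) (α : ℕ → ℝ)
    (hα : ∀ j ≤ n + 1, α j + α (n + 1 - j) = 1) :
    localFunctional 𝓡 n (chainGrad V K n (shiftedOffShell n) fun j => algebraMap ℝ 𝓜 (α j)) =
      Polynomial.C (1 / 2) * Polynomial.derivative (bornPoly V K n) := by
  have h1 := localFunctional_chainGrad_rev V K n α
  have h2 : localFunctional 𝓡 n
      (chainGrad V K n (shiftedOffShell n) fun j => algebraMap ℝ 𝓜 (α j)) +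
      localFunctional 𝓡 n
        (chainGrad V K n (shiftedOffShell n) fun j => algebraMap ℝ 𝓜 (α (n + 1 - j))) =
      Polynomial.derivative (bornPoly V K n) := by
    rw [← map_add, chainGrad_add]
    have h3 := numeratorFunctional_coeffDerivation (Polynomial.derivative' (R := ℝ)) n
      (stateIndicator (Finset.Icc 1 n)) (chain V K n (shiftedOffShell n))
    change _ = Polynomial.derivative (bornPoly V K n) at h3
    rw [← h3, Derivation.map_chain]
    refine congrArg _ (chainGrad_congr V K (fun j hj => rfl) (fun j hj => ?_))
    rw [← map_add, hα j hj, map_one, shiftedOffShell, map_add, C_apply, coeffDerivation_monomial]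
    split_ifs
    · rw [X, coeffDerivation_monomial]
      simp [Polynomial.derivative']
    · simp [Polynomial.derivative']
  have h4 : Polynomial.C (1 / 2 : ℝ) * 2 = 1 := by
    rw [show (2 : 𝓡) = Polynomial.C 2 from rfl, ← Polynomial.C_mul]
    norm_num
  rw [← h2, ← h1, ← two_mul, ← mul_assoc, h4, one_mul]

theorem aeval_C_X (p : Polynomial ℝ) :
    Polynomial.aeval (C Polynomial.X : 𝓜) p = C p := by
  have h := Polynomial.aeval_algHom_apply (Algebra.ofId 𝓡 𝓜 |>.restrictScalars ℝ) Polynomial.X p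
  simpa [Algebra.ofId_apply, algebraMap_eq] using h

/-- The derivation `∑ h_j ∂_j` for the hitting weights of the line `k`. -/
noncomputable def hittingDerivation (n k : ℕ) : Derivation 𝓡 𝓜 𝓜 :=
  mkDerivation 𝓡 fun j =>
    if j ∈ Finset.Icc 1 n then algebraMap ℝ 𝓜 (hittingWeight n k j) else 0

theorem Derivation.finset_sum_apply {ι : Type*} (s : Finset ι) (d : ι → Derivation 𝓡 𝓜 𝓜) (p : 𝓜) :
    (∑ i ∈ s, d i) p = ∑ i ∈ s, d i p := by
  classical
  induction s using Finset.induction_on with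
  | empty => rfl
  | insert i s hi ih =>
    rw [Finset.sum_insert hi, Finset.sum_insert hi, Derivation.add_apply, ih]

theorem hittingDerivation_apply (n k : ℕ) (p : 𝓜) : hittingDerivation n k p =
    ∑ j ∈ Finset.Icc 1 n, C (algebraMap ℝ 𝓡 (hittingWeight n k j)) * pderiv j p := by
  have h : hittingDerivation n k =
      ∑ j ∈ Finset.Icc 1 n, (C (algebraMap ℝ 𝓡 (hittingWeight n k j)) : 𝓜) • pderiv j := by
    refine derivation_ext fun i => ?_
    rw [hittingDerivation, mkDerivation_X, Derivation.finset_sum_apply]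
    simp only [Derivation.smul_apply, pderiv_X, Pi.single_apply, smul_eq_mul, mul_ite, mul_one,
      mul_zero]
    rw [Finset.sum_ite_eq (Finset.Icc 1 n) i]
    rfl
  rw [h, Derivation.finset_sum_apply]
  rfl

theorem localFunctional_eq_sum_cut (n : ℕ) (p : 𝓜) :
    (n : 𝓡) * localFunctional 𝓡 n p =
      ∑ k ∈ Finset.Icc 1 n, cutFunctional 𝓡 n k (hittingDerivation n k p) := by
  rw [← localFunctional_euler, map_sum]
  simp only [localFunctional_X_mul, hittingDerivation_apply, map_sum, C_mul', map_smul, smul_eq_mul]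
  exact Finset.sum_comm

theorem hittingDerivation_shiftedOffShell {n k : ℕ} (hk : k ∈ Finset.Icc 1 n) (j : ℕ) :
    hittingDerivation n k (shiftedOffShell n j) = algebraMap ℝ 𝓜 (hittingWeight n k j) := by
  rw [shiftedOffShell, map_add, derivation_C, zero_add]
  by_cases h : j ∈ Finset.Icc 1 n
  · rw [if_pos (Finset.mem_Icc.mp h), hittingDerivation, mkDerivation_X, if_pos h]
  · rw [if_neg (fun h' => h (Finset.mem_Icc.mpr h')), map_zero,
      (hittingWeight_isHarmonicExt hk).zero j h, map_zero]

theorem cutFunctional_hittingDerivation (a b : ℕ) :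
    cutFunctional 𝓡 (a + b + 1) (a + 1) (hittingDerivation (a + b + 1) (a + 1)
        (chain V K (a + b + 1) (shiftedOffShell (a + b + 1)))) =
      Polynomial.C (1 / 2) * K * Polynomial.derivative (bornPoly V K a * bornPoly V K b) +
        Polynomial.derivative K * (bornPoly V K a * bornPoly V K b) := by
  set n := a + b + 1 with hn
  have hk : a + 1 ∈ Finset.Icc 1 n := Finset.mem_Icc.mpr (by omega)
  set ρ : 𝓜 →ₐ[ℝ] 𝓜 := (restrictVars 𝓡 {i | i ≠ a + 1}).restrictScalars ℝ with hρ
  set τ : 𝓜 →ₐ[ℝ] 𝓜 := (rename (R := 𝓡) (· + (a + 1))).restrictScalars ℝ with hτ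
  have hρz : ∀ j, ρ (shiftedOffShell n j) =
      if j = a + 1 then C Polynomial.X else shiftedOffShell n j := by
    intro j
    rw [hρ, AlgHom.restrictScalars_apply, shiftedOffShell, map_add, ← algebraMap_eq,
      AlgHom.commutes]
    split_ifs with h1 h2 h2
    · rw [restrictVars_X, if_neg (by simpa using h2), add_zero]
    · rw [restrictVars_X, if_pos (by simpa using h2)]
    · rw [map_zero, add_zero]
    · rw [map_zero]
  have hleft : ∀ j ≤ a + 1, ρ (shiftedOffShell n j) = shiftedOffShell a j := by
    intro j hj
    rw [hρz]
    split_ifs with h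
    · rw [shiftedOffShell, if_neg (by omega), add_zero]
    · simp only [shiftedOffShell]
      congr 1
      split_ifs <;> first | rfl | omega
  have hright : ∀ j ≤ b + 1, ρ (shiftedOffShell n (j + (a + 1))) = τ (shiftedOffShell b j) := by
    intro j hj
    rw [hρz, hτ, AlgHom.restrictScalars_apply, shiftedOffShell, shiftedOffShell, map_add, rename_C]
    split_ifs <;> first | omega | simp
  have hres : ∀ w : ℕ → ℝ, restrictVars 𝓡 {i | i ∈ Finset.Icc 1 a}
      (chainGrad V K a (shiftedOffShell a) fun j => algebraMap ℝ 𝓜 (w j)) =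
        chainGrad V K a (shiftedOffShell a) fun j => algebraMap ℝ 𝓜 (w j) := by
    intro w
    rw [← AlgHom.restrictScalars_apply ℝ, map_chainGrad]
    refine chainGrad_congr V K (fun j hj => ?_) (fun j hj => AlgHom.commutes _ _)
    rw [AlgHom.restrictScalars_apply, shiftedOffShell, map_add, ← algebraMap_eq, AlgHom.commutes]
    split_ifs with h
    · rw [restrictVars_X, if_pos (by simpa using h)]
    · rw [map_zero]
  have hres' : restrictVars 𝓡 {i | i ∈ Finset.Icc 1 a} (chain V K a (shiftedOffShell a)) =
      chain V K a (shiftedOffShell a) := by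
    rw [← AlgHom.restrictScalars_apply ℝ, map_chain]
    refine chain_congr V K fun j hj => ?_
    rw [AlgHom.restrictScalars_apply, shiftedOffShell, map_add, ← algebraMap_eq, AlgHom.commutes]
    split_ifs with h
    · rw [restrictVars_X, if_pos (by simpa using h)]
    · rw [map_zero]
  set d : Derivation ℝ 𝓜 𝓜 := (hittingDerivation n (a + 1)).restrictScalars ℝ with hd
  have hdz : ∀ j, d (shiftedOffShell n j) = algebraMap ℝ 𝓜 (hittingWeight n (a + 1) j) :=
    fun j => hittingDerivation_shiftedOffShell hk j
  have hL : ρ (chain V K a (shiftedOffShell n)) = chain V K a (shiftedOffShell a) := by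
    rw [map_chain]
    exact chain_congr V K hleft
  have hR : ρ (chain V K b fun j => shiftedOffShell n (j + (a + 1))) =
      τ (chain V K b (shiftedOffShell b)) := by
    rw [map_chain, map_chain]
    exact chain_congr V K hright
  have hdL : ρ (d (chain V K a (shiftedOffShell n))) =
      chainGrad V K a (shiftedOffShell a) fun j => algebraMap ℝ 𝓜 ((j : ℝ) / (a + 1)) := by
    rw [Derivation.map_chain, map_chainGrad]
    refine chainGrad_congr V K hleft fun j hj => ?_
    rw [hdz, AlgHom.commutes, hittingWeight, if_pos hj]
    push_cast
    rfl
  have hdR : ρ (d (chain V K b fun j => shiftedOffShell n (j + (a + 1)))) =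
      τ (chainGrad V K b (shiftedOffShell b) fun j =>
        algebraMap ℝ 𝓜 (((b + 1 - j : ℕ) : ℝ) / (b + 1))) := by
    rw [Derivation.map_chain, map_chainGrad, map_chainGrad]
    refine chainGrad_congr V K hright fun j hj => ?_
    rw [hdz, AlgHom.commutes, AlgHom.commutes, hittingWeight]
    congr 1
    have hb : ((b : ℝ) + 1) ≠ 0 := by positivity
    have ha : ((a : ℝ) + 1) ≠ 0 := by positivity
    split_ifs with h
    · obtain rfl : j = 0 := by omega
      push_cast
      rw [zero_add, div_self ha, div_self hb]
    · rw [show n + 1 - (j + (a + 1)) = b + 1 - j by omega, show n + 1 - (a + 1) = b + 1 by omega]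
      push_cast
      rfl
  have hK : ∀ p : Polynomial ℝ,
      ρ (Polynomial.aeval (shiftedOffShell n (a + 1)) p) = C p := by
    intro p
    rw [← Polynomial.aeval_algHom_apply, hρz, if_pos rfl, aeval_C_X]
  have hdK : d (Polynomial.aeval (shiftedOffShell n (a + 1)) K) =
      Polynomial.aeval (shiftedOffShell n (a + 1)) (Polynomial.derivative K) := by
    have h1 : hittingWeight n (a + 1) (a + 1) = 1 := by
      rw [hittingWeight, if_pos le_rfl, div_self]
      positivity
    rw [Derivation.map_aeval, hdz, h1, map_one, smul_eq_mul, mul_one]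
  have hsplit : ∀ A B : 𝓜, restrictVars 𝓡 {i | i ∈ Finset.Icc 1 a} A = A → ∀ p : Polynomial ℝ,
      cutFunctional 𝓡 n (a + 1) (A * C p * τ B) =
        p * (localFunctional 𝓡 a A * localFunctional 𝓡 b B) := by
    intro A B hA p
    rw [mul_right_comm, mul_comm _ (C p), C_mul', map_smul, smul_eq_mul, hτ,
      AlgHom.restrictScalars_apply, cutFunctional_split a b A B hA]
  have hmain : ρ (d (chain V K n (shiftedOffShell n))) =
      (chainGrad V K a (shiftedOffShell a) fun j => algebraMap ℝ 𝓜 ((j : ℝ) / (a + 1))) * C K *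
          τ (chain V K b (shiftedOffShell b)) +
        chain V K a (shiftedOffShell a) * C (Polynomial.derivative K) *
          τ (chain V K b (shiftedOffShell b)) +
        chain V K a (shiftedOffShell a) * C K *
          τ (chainGrad V K b (shiftedOffShell b) fun j =>
            algebraMap ℝ 𝓜 (((b + 1 - j : ℕ) : ℝ) / (b + 1))) := by
    rw [hn, chain_split, ← hn, Derivation.leibniz, Derivation.leibniz, hdK]
    simp only [smul_eq_mul, map_add, map_mul, hL, hR, hdL, hdR, hK]
    ring
  rw [← cutFunctional_restrictVars]
  change cutFunctional 𝓡 n (a + 1) (ρ (d (chain V K n (shiftedOffShell n)))) = _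
  rw [hmain, map_add, map_add, hsplit _ _ (hres _), hsplit _ _ hres', hsplit _ _ hres',
    localFunctional_chainGrad_half V K a fun j => (j : ℝ) / (a + 1),
    localFunctional_chainGrad_half V K b fun j => ((b + 1 - j : ℕ) : ℝ) / (b + 1),
    Polynomial.derivative_mul]
  · change K * (_ * _ * bornPoly V K b) + _ * (bornPoly V K a * bornPoly V K b) +
      K * (bornPoly V K a * _) = _
    ring
  · intro j hj
    rw [show b + 1 - (b + 1 - j) = j by omega, ← add_div, div_eq_one_iff_eq (by positivity)]
    push_cast [hj]
    ring
  · intro j hj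
    rw [← add_div, div_eq_one_iff_eq (by positivity)]
    push_cast [hj]
    ring

theorem bornPoly_zero : bornPoly V K 0 = V := by
  have h0 : chain V K 0 (shiftedOffShell 0) = C V := by
    have : ∀ j, shiftedOffShell 0 j = C Polynomial.X := fun j => by
      rw [shiftedOffShell, if_neg (by omega), add_zero]
    simp only [chain, this, zero_add, Finset.prod_range_one]
    rw [← two_mul, ← mul_assoc, algebraMap_eq_C_C, ← map_ofNat C, ← map_mul]
    have h2 : Polynomial.C (1 / 2 : ℝ) * 2 = 1 := by
      rw [show (2 : 𝓡) = Polynomial.C 2 from rfl, ← Polynomial.C_mul]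
      norm_num
    rw [h2, map_one, one_mul, aeval_C_X]
    simp
  rw [bornPoly, h0, C_apply, numeratorFunctional_monomial, monomialWeight]
  simp [run_nil, stateIndicator]

/-- The local parts of the iterations, times `K`, are the Taylor coefficients in `t` of the solution
of `∂_t G = G ∂_s G`. -/
theorem bornPoly_recursion (N : ℕ) :
    2 * ((N : 𝓡) + 1) * (K * bornPoly V K (N + 1)) = Polynomial.derivative
      (∑ x ∈ Finset.HasAntidiagonal.antidiagonal N,
        K * bornPoly V K x.1 * (K * bornPoly V K x.2)) := by
  have h := localFunctional_eq_sum_cut (N + 1) (chain V K (N + 1) (shiftedOffShell (N + 1)))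
  rw [sum_Icc_one] at h
  rw [map_sum, Finset.Nat.sum_antidiagonal_eq_sum_range_succ_mk]
  have hk : ∀ k ∈ Finset.range (N + 1), cutFunctional 𝓡 (N + 1) (k + 1)
      (hittingDerivation (N + 1) (k + 1) (chain V K (N + 1) (shiftedOffShell (N + 1)))) =
      Polynomial.C (1 / 2) * K * Polynomial.derivative (bornPoly V K k * bornPoly V K (N - k)) +
        Polynomial.derivative K * (bornPoly V K k * bornPoly V K (N - k)) := fun k hk => by
    have h' := cutFunctional_hittingDerivation V K k (N - k)
    rwa [Nat.add_sub_cancel' (Nat.lt_succ_iff.mp (Finset.mem_range.mp hk))] at h'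
  rw [Finset.sum_congr rfl hk] at h
  change ((N + 1 : ℕ) : 𝓡) * bornPoly V K (N + 1) = _ at h
  rw [Nat.cast_succ] at h
  have h2 : 2 * Polynomial.C (1 / 2 : ℝ) = 1 := by
    rw [show (2 : 𝓡) = Polynomial.C 2 from rfl, ← Polynomial.C_mul]
    norm_num
  rw [mul_left_comm, mul_assoc, h, mul_left_comm, Finset.mul_sum, Finset.mul_sum]
  refine Finset.sum_congr rfl fun k _ => ?_
  simp only [Polynomial.derivative_mul]
  linear_combination (K * K * (Polynomial.derivative (bornPoly V K k) * bornPoly V K (N - k) +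
    bornPoly V K k * Polynomial.derivative (bornPoly V K (N - k)))) * h2

end Recursion

section Lagrange

variable {A : Type*} [CommRing A] [Algebra ℝ A]

/-- The derivation of `A⟦X⟧` that acts on the coefficients. -/
noncomputable def PowerSeries.coeffDerivation (d : Derivation ℝ A A) :
    Derivation ℝ (PowerSeries A) (PowerSeries A) :=
  Derivation.mk'
    { toFun := fun p => PowerSeries.mk fun n => d (PowerSeries.coeff n p)
      map_add' := fun p q => by ext n; simp
      map_smul' := fun c p => by ext n; simp }
    (fun p q => by
      ext n
      rw [smul_eq_mul, smul_eq_mul, mul_comm q]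
      change PowerSeries.coeff n (PowerSeries.mk fun n => d (PowerSeries.coeff n (p * q))) =
        PowerSeries.coeff n (p * (PowerSeries.mk fun n => d (PowerSeries.coeff n q)) +
          (PowerSeries.mk fun n => d (PowerSeries.coeff n p)) * q)
      simp only [map_add, PowerSeries.coeff_mk, PowerSeries.coeff_mul, map_sum, Derivation.leibniz,
        smul_eq_mul]
      rw [← Finset.sum_add_distrib]
      exact Finset.sum_congr rfl fun x _ => by ring)

theorem PowerSeries.coeff_coeffDerivation (d : Derivation ℝ A A) (p : PowerSeries A) (n : ℕ) :
    coeff n (coeffDerivation d p) = d (coeff n p) :=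
  coeff_mk n fun n => d (coeff n p)

variable [IsDomain A]

/-- Lagrange inversion in the form of the equation `∂_t G = G ∂_s G`. -/
theorem coeff_pow_of_burgers (d : Derivation ℝ A A) (g : ℕ → A)
    (hg : ∀ N : ℕ, 2 * ((N : A) + 1) * g (N + 1) =
      d (∑ x ∈ Finset.HasAntidiagonal.antidiagonal N, g x.1 * g x.2)) (n m : ℕ) :
    ((n.factorial : A) * (n + m)) * PowerSeries.coeff n (PowerSeries.mk g ^ m) =
      m * (d^[n]) (g 0 ^ (n + m)) := by
  have hA : CharZero A := charZero_of_injective_algebraMap (algebraMap ℝ A).injective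
  have hA' : CharZero (PowerSeries A) :=
    charZero_of_injective_algebraMap (algebraMap ℝ (PowerSeries A)).injective
  set G := PowerSeries.mk g with hG
  set δ := PowerSeries.coeffDerivation d
  have h1 : PowerSeries.derivative A G = G * δ G := by
    have h2 : 2 * PowerSeries.derivative A G = δ (G * G) := by
      ext N
      rw [PowerSeries.coeff_coeffDerivation, PowerSeries.coeff_mul N G G]
      simp only [hG, PowerSeries.coeff_mk]
      rw [← hg N, show (2 : PowerSeries A) = PowerSeries.C 2 from rfl, PowerSeries.coeff_C_mul,
        PowerSeries.coeff_derivative, PowerSeries.coeff_mk]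
      ring
    rw [Derivation.leibniz, smul_eq_mul, ← two_mul] at h2
    exact mul_left_cancel₀ two_ne_zero h2
  have h3 : ∀ m : ℕ, ((m : PowerSeries A) + 1) * PowerSeries.derivative A (G ^ m) =
      m * δ (G ^ (m + 1)) := by
    intro m
    rcases m with _ | m
    · simp
    · rw [Derivation.leibniz_pow, Derivation.leibniz_pow, h1]
      simp only [Nat.add_sub_cancel, nsmul_eq_mul, smul_eq_mul]
      push_cast
      ring
  have h4 : ∀ n m : ℕ, ((m : A) + 1) * ((n + 1) * PowerSeries.coeff (n + 1) (G ^ m)) =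
      m * d (PowerSeries.coeff n (G ^ (m + 1))) := by
    intro n m
    have h := congrArg (PowerSeries.coeff n) (h3 m)
    have e1 : ((m : PowerSeries A) + 1) = PowerSeries.C ((m : A) + 1) := by simp
    have e2 : (m : PowerSeries A) = PowerSeries.C (m : A) := by simp
    rw [e1, e2, PowerSeries.coeff_C_mul, PowerSeries.coeff_C_mul, PowerSeries.coeff_derivative,
      PowerSeries.coeff_coeffDerivation] at h
    rw [← h]
    ring
  induction n generalizing m with
  | zero =>
    simp [hG]
  | succ n ih =>
    have hm : ((m : A) + 1) ≠ 0 := by exact_mod_cast m.succ_ne_zero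
    refine mul_left_cancel₀ hm ?_
    have ih' := congrArg d (ih (m + 1))
    have e1 : ((n.factorial : A) * (n + (m + 1 : ℕ))) =
      ((n.factorial * (n + (m + 1)) : ℕ) : A) := by push_cast; rfl
    rw [e1, ← nsmul_eq_mul, ← nsmul_eq_mul, map_nsmul, map_nsmul, nsmul_eq_mul, nsmul_eq_mul,
      ← Function.iterate_succ_apply' d, show n + (m + 1) = n + 1 + m by ring] at ih'
    rw [Nat.factorial_succ]
    push_cast at ih' ⊢
    linear_combination (m : A) * ih' + ((n.factorial : A) * (n + 1 + m)) * h4 n m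

/-- The solution of `∂_t G = G ∂_s G` with `G = f` at `t = 0`, as a power series in `t`. -/
noncomputable def burgersCoeff (f : PowerSeries ℝ) : ℕ → PowerSeries ℝ
  | 0 => f
  | n + 1 => PowerSeries.C (1 / (2 * ((n : ℝ) + 1))) * PowerSeries.derivative ℝ
      (∑ i : Fin (n + 1), burgersCoeff f i * burgersCoeff f (n - i))

theorem burgersCoeff_succ (f : PowerSeries ℝ) (N : ℕ) :
    2 * ((N : PowerSeries ℝ) + 1) * burgersCoeff f (N + 1) = PowerSeries.derivative ℝ
      (∑ x ∈ Finset.HasAntidiagonal.antidiagonal N, burgersCoeff f x.1 * burgersCoeff f x.2) := by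
  have e : 2 * ((N : PowerSeries ℝ) + 1) = PowerSeries.C (2 * ((N : ℝ) + 1)) := by
    rw [map_mul, map_add, map_natCast, map_one]
    rfl
  rw [burgersCoeff, e, ← mul_assoc, ← map_mul, mul_one_div_cancel (by positivity), map_one, one_mul,
    Finset.Nat.sum_antidiagonal_eq_sum_range_succ_mk, Finset.sum_range]

/-- Lagrange inversion: the power series `Y` with `t Y(t) = t f (t Y(t))`. -/
theorem exists_lagrange (f : PowerSeries ℝ) : ∃ Y : PowerSeries ℝ, ∀ n m : ℕ,
    ((n : ℝ) + m) * PowerSeries.coeff n (Y ^ m) = m * PowerSeries.coeff n (f ^ (n + m)) := by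
  refine ⟨PowerSeries.map PowerSeries.constantCoeff (PowerSeries.mk (burgersCoeff f)),
    fun n m => ?_⟩
  have h := congrArg PowerSeries.constantCoeff
    (coeff_pow_of_burgers (PowerSeries.derivative ℝ) (burgersCoeff f) (burgersCoeff_succ f) n m)
  rw [burgersCoeff] at h
  rw [← map_pow, PowerSeries.coeff_map]
  simp only [map_mul, map_add, map_natCast] at h
  rw [PowerSeries.constantCoeff_iterate_derivative] at h
  have hn : (n.factorial : ℝ) ≠ 0 := by positivity
  refine mul_left_cancel₀ hn ?_
  linear_combination h

theorem lagrange_fixed_point {f Y : PowerSeries ℝ} (h : ∀ n m : ℕ,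
    ((n : ℝ) + m) * PowerSeries.coeff n (Y ^ m) = m * PowerSeries.coeff n (f ^ (n + m))) (N : ℕ) :
    PowerSeries.coeff N Y = ∑ x ∈ Finset.HasAntidiagonal.antidiagonal N,
      PowerSeries.coeff x.1 f * PowerSeries.coeff x.2 (Y ^ x.1) := by
  rcases N with _ | M
  · have := h 0 1
    simp at this
    simp [this]
  · have hM : ((M : ℝ) + 1) ≠ 0 := by positivity
    have hM2 : ((M : ℝ) + 2) ≠ 0 := by positivity
    refine mul_left_cancel₀ (mul_ne_zero hM hM2) ?_
    have h1 : ((M : ℝ) + 1) * ∑ x ∈ Finset.HasAntidiagonal.antidiagonal (M + 1),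
        PowerSeries.coeff x.1 f * PowerSeries.coeff x.2 (Y ^ x.1) =
        PowerSeries.coeff M (PowerSeries.derivative ℝ f * f ^ (M + 1)) := by
      rw [PowerSeries.coeff_mul, Finset.mul_sum]
      have e : ∀ x ∈ Finset.HasAntidiagonal.antidiagonal (M + 1),
          ((M : ℝ) + 1) * (PowerSeries.coeff x.1 f * PowerSeries.coeff x.2 (Y ^ x.1)) =
          x.1 * PowerSeries.coeff x.1 f * PowerSeries.coeff x.2 (f ^ (M + 1)) := by
        intro x hx
        have hx' := Finset.HasAntidiagonal.mem_antidiagonal.mp hx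
        have := h x.2 x.1
        rw [add_comm x.2, hx', ← Nat.cast_add, add_comm x.2, hx'] at this
        push_cast at this
        linear_combination PowerSeries.coeff x.1 f * this
      rw [Finset.sum_congr rfl e, Finset.Nat.sum_antidiagonal_succ]
      simp only [Nat.cast_zero, zero_mul, zero_add, PowerSeries.coeff_derivative]
      refine Finset.sum_congr rfl fun x _ => ?_
      push_cast
      ring
    have h2 := h (M + 1) 1
    have h3 : PowerSeries.coeff M (PowerSeries.derivative ℝ (f ^ (M + 2))) =
        ((M : ℝ) + 2) * PowerSeries.coeff M (PowerSeries.derivative ℝ f * f ^ (M + 1)) := by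
      rw [Derivation.leibniz_pow, ← PowerSeries.coeff_C_mul]
      congr 1
      rw [nsmul_eq_mul, smul_eq_mul, map_add, map_natCast]
      push_cast
      rw [show (PowerSeries.C (2 : ℝ)) = 2 from rfl]
      ring
    rw [PowerSeries.coeff_derivative] at h3
    rw [pow_one] at h2
    push_cast at h2
    rw [show M + 1 + 1 = M + 2 by ring] at h2
    linear_combination ((M : ℝ) + 1) * h2 + h3 - ((M : ℝ) + 2) * h1

/-- The closed form of the local parts of the iterations. -/
theorem coeff_zero_bornPoly (V K : Polynomial ℝ) (n : ℕ) :
    ((n : ℝ) + 1) * (K.coeff 0 * (bornPoly V K n).coeff 0) = ((K * V) ^ (n + 1)).coeff n := by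
  have h := coeff_pow_of_burgers (Polynomial.derivative' (R := ℝ)) (fun n => K * bornPoly V K n)
    (bornPoly_recursion V K) n 1
  rw [pow_one, PowerSeries.coeff_mk, bornPoly_zero] at h
  have h' := congrArg (Polynomial.coeff · 0) h
  have e : ((n.factorial : Polynomial ℝ) * (n + (1 : ℕ))) =
      Polynomial.C ((n.factorial : ℝ) * (n + 1)) := by simp
  rw [e] at h'
  change _ = Polynomial.coeff (((1 : ℕ) : Polynomial ℝ) *
    (Polynomial.derivative^[n] ((K * V) ^ (n + 1)))) 0 at h'
  simp only [Polynomial.coeff_C_zero, Polynomial.mul_coeff_zero, Nat.cast_one, one_mul] at h'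
  rw [Polynomial.coeff_iterate_derivative, zero_add, Nat.descFactorial_self, nsmul_eq_mul] at h'
  have hn : (n.factorial : ℝ) ≠ 0 := by positivity
  refine mul_left_cancel₀ hn ?_
  linear_combination h'

end Lagrange

section BornTerm

open MvPolynomial

/-- The Taylor series of `f` at `0`. -/
noncomputable def taylorSeries (f : ℝ → ℝ) : PowerSeries ℝ :=
  PowerSeries.mk fun k => iteratedDeriv k f 0 / (Nat.factorial k : ℝ)

theorem coeff_taylorPoly (f : ℝ → ℝ) {n k : ℕ} (hk : k ≤ n) :
    (taylorPoly f n).coeff k = iteratedDeriv k f 0 / (Nat.factorial k : ℝ) := by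
  rw [taylorPoly, Polynomial.finsetSum_coeff, Finset.sum_eq_single k]
  · simp
  · intro j _ hj
    rw [Polynomial.coeff_C_mul_X_pow, if_neg hj.symm]
  · intro h
    exact absurd (Finset.mem_range.mpr (by omega)) h

theorem X_pow_dvd_taylorPoly_sub (f : ℝ → ℝ) (n : ℕ) :
    (PowerSeries.X : PowerSeries ℝ) ^ (n + 1) ∣ (taylorPoly f n : PowerSeries ℝ) - taylorSeries f := by
  rw [PowerSeries.X_pow_dvd_iff]
  intro k hk
  rw [map_sub, Polynomial.coeff_coe, coeff_taylorPoly f (Nat.lt_succ_iff.mp hk), taylorSeries,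
    PowerSeries.coeff_mk, sub_self]

theorem coeff_taylorPoly_mul_pow (f g : ℝ → ℝ) (n m : ℕ) :
    ((taylorPoly f n * taylorPoly g n) ^ m).coeff n =
      PowerSeries.coeff n ((taylorSeries f * taylorSeries g) ^ m) := by
  rw [← Polynomial.coeff_coe, ← sub_eq_zero, ← map_sub, Polynomial.coe_pow, Polynomial.coe_mul]
  refine PowerSeries.X_pow_dvd_iff.mp (dvd_trans ?_ (sub_dvd_pow_sub_pow _ _ m)) n n.lt_succ_self
  have e : ∀ A B A' B' : PowerSeries ℝ, A * B - A' * B' = A * (B - B') + (A - A') * B' := by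
    intros
    ring
  rw [e]
  exact dvd_add ((X_pow_dvd_taylorPoly_sub g n).mul_left _)
    ((X_pow_dvd_taylorPoly_sub f n).mul_right _)

theorem bornNumerator_eq_chain (m₁ m₂ y₀ : ℝ) (U : ℝ → ℝ) (n : ℕ) :
    bornNumerator m₁ m₂ y₀ U n = chain (taylorPoly (fun x => U (y₀ + x)) n)
      (taylorPoly (reducedPropagator m₁ m₂ y₀) n) n (offShell n) := rfl

theorem classicalPart_chain (V K : Polynomial ℝ) (n : ℕ) :
    classicalPart n (chain V K n (offShell n)) = (bornPoly V K n).coeff 0 := by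
  have h1 : restrictVars ℝ {i | i ∈ Finset.Icc 1 n} (chain V K n (offShell n)) =
      chain V K n (offShell n) := by
    rw [map_chain]
    refine chain_congr V K fun j _ => ?_
    rw [offShell]
    split_ifs with h
    · rw [restrictVars_X, if_pos (by simpa using h)]
    · rw [map_zero]
  have h2 : chain V K n (offShell n) =
      mapAlgHom (Polynomial.aeval (0 : ℝ)) (chain V K n (shiftedOffShell n)) := by
    rw [map_chain]
    refine chain_congr V K fun j _ => ?_
    rw [shiftedOffShell, map_add, mapAlgHom_apply, mapAlgHom_apply, offShell]
    split_ifs <;> simp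
  rw [classicalPart_eq_localFunctional n _ h1, h2]
  have h3 := localFunctional_map (Polynomial.aeval (0 : ℝ)) n (chain V K n (shiftedOffShell n))
  rw [mapAlgHom_apply]
  refine h3.trans ?_
  rw [← Polynomial.coeff_zero_eq_aeval_zero']
  rfl

/-- The classical parts of the iterations are the Lagrange coefficients of the equation
`x = K(x) V(x)`. -/
theorem classicalPart_bornNumerator (m₁ m₂ y₀ : ℝ) (U : ℝ → ℝ) (n : ℕ) :
    ((n : ℝ) + 1) * (reducedPropagator m₁ m₂ y₀ 0 * classicalPart n (bornNumerator m₁ m₂ y₀ U n)) =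
      PowerSeries.coeff n
        ((taylorSeries (reducedPropagator m₁ m₂ y₀) * taylorSeries fun x => U (y₀ + x)) ^ (n + 1)) := by
  have h := coeff_zero_bornPoly (taylorPoly (fun x => U (y₀ + x)) n)
    (taylorPoly (reducedPropagator m₁ m₂ y₀) n) n
  rw [coeff_taylorPoly_mul_pow, coeff_taylorPoly _ (Nat.zero_le n)] at h
  rw [bornNumerator_eq_chain, classicalPart_chain, ← h]
  simp

end BornTerm

section Majorant

open PowerSeries

theorem abs_coeff_pow_le {f : PowerSeries ℝ} {C B : ℝ} (hC : 0 ≤ C) (hB : 0 ≤ B)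
    (hf : ∀ k, |coeff k f| ≤ C * B ^ k) (m n : ℕ) :
    |coeff n (f ^ m)| ≤ (2 * C) ^ m * (2 * B) ^ n := by
  induction m generalizing n with
  | zero =>
    rw [pow_zero, pow_zero, one_mul, coeff_one]
    split_ifs with h
    · simp [h]
    · rw [abs_zero]
      positivity
  | succ m ih =>
    rw [pow_succ, coeff_mul, Finset.Nat.sum_antidiagonal_eq_sum_range_succ_mk]
    calc |∑ k ∈ Finset.range n.succ, coeff k (f ^ m) * coeff (n - k) f|
        ≤ ∑ k ∈ Finset.range n.succ, |coeff k (f ^ m) * coeff (n - k) f| :=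
          Finset.abs_sum_le_sum_abs _ _
      _ ≤ ∑ k ∈ Finset.range n.succ, (2 * C) ^ m * C * B ^ n * 2 ^ k := by
          refine Finset.sum_le_sum fun k hk => ?_
          have hk' : k ≤ n := Nat.lt_succ_iff.mp (Finset.mem_range.mp hk)
          rw [abs_mul]
          calc |coeff k (f ^ m)| * |coeff (n - k) f|
              ≤ ((2 * C) ^ m * (2 * B) ^ k) * (C * B ^ (n - k)) :=
                mul_le_mul (ih k) (hf _) (abs_nonneg _) (by positivity)
            _ = (2 * C) ^ m * C * (B ^ k * B ^ (n - k)) * 2 ^ k := by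
                rw [mul_pow 2 B]
                ring
            _ = _ := by rw [← pow_add, Nat.add_sub_cancel' hk']
      _ = (2 * C) ^ m * C * B ^ n * ∑ k ∈ Finset.range n.succ, (2 : ℝ) ^ k := by
          rw [Finset.mul_sum]
      _ ≤ (2 * C) ^ m * C * B ^ n * 2 ^ (n + 1) := by
          refine mul_le_mul_of_nonneg_left ?_ (by positivity)
          rw [geom_sum_eq (by norm_num)]
          norm_num
      _ = _ := by
          rw [mul_pow 2 B]
          ring

theorem abs_coeff_lagrange_le {f Y : PowerSeries ℝ} {C B : ℝ} (hC : 0 ≤ C) (hB : 0 ≤ B)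
    (hf : ∀ k, |coeff k f| ≤ C * B ^ k)
    (h : ∀ n m : ℕ, ((n : ℝ) + m) * coeff n (Y ^ m) = m * coeff n (f ^ (n + m))) (n m : ℕ) :
    |coeff n (Y ^ m)| ≤ (2 * C) ^ m * (4 * C * B) ^ n := by
  have e : (2 * C) ^ m * (4 * C * B) ^ n = (2 * C) ^ (n + m) * (2 * B) ^ n := by
    rw [pow_add, show 4 * C * B = (2 * C) * (2 * B) by ring, mul_pow (2 * C)]
    ring
  rcases Nat.eq_zero_or_pos m with rfl | hm
  · rw [pow_zero, coeff_one]
    split_ifs with h0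
    · simp [h0]
    · rw [abs_zero]
      positivity
  · have hpos : (0 : ℝ) < (n : ℝ) + m := by
      have : (0 : ℝ) < m := by exact_mod_cast hm
      positivity
    have h1 := congrArg abs (h n m)
    rw [abs_mul, abs_mul, abs_of_pos hpos, Nat.abs_cast] at h1
    have h2 := abs_coeff_pow_le hC hB hf (n + m) n
    rw [e]
    refine le_of_mul_le_mul_left (h1.trans_le ?_) hpos
    calc (m : ℝ) * |coeff n (f ^ (n + m))| ≤ ((n : ℝ) + m) * |coeff n (f ^ (n + m))| :=
          mul_le_mul_of_nonneg_right (by linarith [(Nat.cast_nonneg n : (0 : ℝ) ≤ n)]) (abs_nonneg _)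
      _ ≤ _ := mul_le_mul_of_nonneg_left h2 hpos.le

/-- The sum of the Lagrange series of a power series with small coefficients solves `y = f(y)`. -/
theorem lagrange_hasSum {f Y : PowerSeries ℝ} {C B : ℝ} (hC : 0 ≤ C) (hB : 0 ≤ B)
    (hf : ∀ k, |coeff k f| ≤ C * B ^ k) (hq : 4 * C * B ≤ 1 / 2)
    (h : ∀ n m : ℕ, ((n : ℝ) + m) * coeff n (Y ^ m) = m * coeff n (f ^ (n + m))) :
    Summable (fun n => coeff n Y) ∧ |∑' n, coeff n Y| ≤ 4 * C ∧
      HasSum (fun k => coeff k f * (∑' n, coeff n Y) ^ k) (∑' n, coeff n Y) := by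
  set q := 4 * C * B with hq'
  have hq0 : 0 ≤ q := by positivity
  have hbd : ∀ n m : ℕ, |coeff n (Y ^ m)| ≤ (2 * C) ^ m * q ^ n := abs_coeff_lagrange_le hC hB hf h
  have hgeo : Summable fun n : ℕ => q ^ n := summable_geometric_of_lt_one hq0 (by linarith)
  have hsum : ∀ m : ℕ, Summable fun n => ‖coeff n (Y ^ m)‖ := fun m =>
    Summable.of_nonneg_of_le (fun n => norm_nonneg _) (fun n => hbd n m) (hgeo.mul_left _)
  have hsum1 : Summable fun n => ‖coeff n Y‖ := by simpa using hsum 1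
  have hpow : ∀ m : ℕ, ∑' n, coeff n (Y ^ m) = (∑' n, coeff n Y) ^ m := by
    intro m
    induction m with
    | zero =>
      rw [pow_zero, pow_zero, tsum_eq_single 0]
      · simp
      · intro n hn
        rw [coeff_one, if_neg hn]
    | succ m ih =>
      rw [pow_succ (∑' n, coeff n Y), ← ih,
        tsum_mul_tsum_eq_tsum_sum_antidiagonal_of_summable_norm (hsum m) hsum1]
      exact tsum_congr fun n => by rw [pow_succ, coeff_mul]
  have hy : |∑' n, coeff n Y| ≤ 4 * C := by
    have h1 : HasSum (fun n : ℕ => 2 * C * q ^ n) (2 * C * (1 - q)⁻¹) :=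
      (hasSum_geometric_of_lt_one hq0 (by linarith)).mul_left _
    have h2 := tsum_of_norm_bounded h1 (f := fun n => coeff n Y) fun n => by
      simpa using hbd n 1
    refine h2.trans ?_
    have h3 : (1 - q)⁻¹ ≤ 2 := by
      rw [inv_le_comm₀ (by linarith) (by norm_num)]
      linarith
    nlinarith
  refine ⟨hsum1.of_norm, hy, ?_⟩
  have hF : Summable fun x : ℕ × ℕ => coeff x.1 f * coeff x.2 (Y ^ x.1) := by
    have h1 : Summable fun x : ℕ × ℕ => (C * (q / 2) ^ x.1) * q ^ x.2 :=
      Summable.mul_of_nonneg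
        ((summable_geometric_of_lt_one (by positivity) (by linarith)).mul_left C) hgeo
        (fun n => by positivity) (fun n => by positivity)
    refine Summable.of_norm_bounded h1 fun x => ?_
    rw [norm_mul, Real.norm_eq_abs, Real.norm_eq_abs]
    calc |coeff x.1 f| * |coeff x.2 (Y ^ x.1)|
        ≤ (C * B ^ x.1) * ((2 * C) ^ x.1 * q ^ x.2) :=
          mul_le_mul (hf _) (hbd _ _) (abs_nonneg _) (by positivity)
      _ = C * (B * (2 * C)) ^ x.1 * q ^ x.2 := by
          rw [mul_pow B]
          ring
      _ = _ := by
          rw [show B * (2 * C) = q / 2 by rw [hq']; ring]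
  have h1 : HasSum (fun k => coeff k f * (∑' n, coeff n Y) ^ k)
      (∑' x : ℕ × ℕ, coeff x.1 f * coeff x.2 (Y ^ x.1)) := by
    refine hF.hasSum.prod_fiberwise fun k => ?_
    rw [← hpow k]
    exact ((hsum k).of_norm.hasSum).mul_left _
  have h2 : HasSum (fun N => coeff N Y)
      (∑' x : ℕ × ℕ, coeff x.1 f * coeff x.2 (Y ^ x.1)) := by
    have h3 := (Finset.HasAntidiagonal.sigmaAntidiagonalEquivProd (A := ℕ)).hasSum_iff.mpr hF.hasSum
    refine h3.sigma fun N => ?_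
    rw [lagrange_fixed_point h N]
    exact Finset.hasSum (Finset.HasAntidiagonal.antidiagonal N)
      (fun x : ℕ × ℕ => coeff x.1 f * coeff x.2 (Y ^ x.1))
  rw [h2.tsum_eq]
  rwa [h2.tsum_eq] at h1

end Majorant

section Taylor

theorem coeff_taylorSeries (f : ℝ → ℝ) (k : ℕ) :
    PowerSeries.coeff k (taylorSeries f) = iteratedDeriv k f 0 / (Nat.factorial k : ℝ) :=
  PowerSeries.coeff_mk _ _

theorem taylorSeries_mul {f g : ℝ → ℝ} (hf : AnalyticAt ℝ f 0) (hg : AnalyticAt ℝ g 0) :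
    taylorSeries (f * g) = taylorSeries f * taylorSeries g := by
  ext n
  rw [PowerSeries.coeff_mul, Finset.Nat.sum_antidiagonal_eq_sum_range_succ_mk, coeff_taylorSeries,
    iteratedDeriv_mul hf.contDiffAt hg.contDiffAt, Finset.sum_div]
  refine Finset.sum_congr rfl fun k hk => ?_
  have hk' : k ≤ n := Nat.lt_succ_iff.mp (Finset.mem_range.mp hk)
  rw [coeff_taylorSeries, coeff_taylorSeries, Nat.cast_choose ℝ hk']
  have h1 : (k.factorial : ℝ) ≠ 0 := by positivity
  have h2 : ((n - k).factorial : ℝ) ≠ 0 := by positivity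
  have h3 : (n.factorial : ℝ) ≠ 0 := by positivity
  field_simp

open scoped NNReal ENNReal Topology

/-- Taylor series in the first variable of an analytic function of several variables. -/
theorem hasSum_taylorSeries_of_hasFPowerSeriesOnBall {E : Type*} [NormedAddCommGroup E]
    [NormedSpace ℝ E] {F : ℝ × E → ℝ} {p : FormalMultilinearSeries ℝ (ℝ × E) ℝ} {r : ℝ≥0∞}
    (hp : HasFPowerSeriesOnBall F p 0 r) {ρ : ℝ≥0} (hρ0 : 0 < ρ) (hρ : (ρ : ℝ≥0∞) + ρ < r) {e : E}
    (he : ‖e‖₊ < ρ) :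
    (∀ k, PowerSeries.coeff k (taylorSeries fun x => F (x, e)) =
      p.changeOrigin (0, e) k fun _ => (1, 0)) ∧
    ∀ x : ℝ, |x| < ρ →
      HasSum (fun k => PowerSeries.coeff k (taylorSeries fun x => F (x, e)) * x ^ k) (F (x, e)) := by
  have hnorm : ‖((0, e) : ℝ × E)‖₊ = ‖e‖₊ := by
    rw [Prod.nnnorm_def]
    simp
  have hlt : (‖((0, e) : ℝ × E)‖₊ : ℝ≥0∞) < r := by
    rw [hnorm]
    refine lt_of_lt_of_le (ENNReal.coe_lt_coe.mpr he) (le_trans ?_ hρ.le)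
    exact le_self_add
  have hq := hp.changeOrigin hlt
  have hrad : (ρ : ℝ≥0∞) < r - ‖((0, e) : ℝ × E)‖₊ := by
    rw [hnorm]
    refine lt_tsub_iff_right.mpr (lt_of_le_of_lt ?_ hρ)
    gcongr
  set q := p.changeOrigin (0, e) with hqdef
  have hsumq : ∀ x : ℝ, |x| < ρ → HasSum (fun k => (q k fun _ => (1, 0)) * x ^ k) (F (x, e)) := by
    intro x hx
    have hmem : ((x, 0) : ℝ × E) ∈ Metric.eball (0 : ℝ × E) (r - ‖((0, e) : ℝ × E)‖₊) := by
      rw [Metric.mem_eball, edist_zero_right]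
      refine lt_of_lt_of_le ?_ hrad.le
      rw [enorm_eq_nnnorm, ENNReal.coe_lt_coe, Prod.nnnorm_def]
      simpa [← NNReal.coe_lt_coe, hρ0] using hx
    have h := hq.hasSum hmem
    simp only [zero_add, Prod.mk_add_mk, add_zero] at h
    have e : (fun k => (q k fun _ => (1, 0)) * x ^ k) = fun k => q k fun _ => (x, 0) := funext fun k => ?_
    · rwa [e]
    have : (fun _ : Fin k => ((x, 0) : ℝ × E)) = fun _ => x • ((1, 0) : ℝ × E) := by
      funext i
      simp
    rw [this, ContinuousMultilinearMap.map_smul_univ]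
    simp [mul_comm]
  have hcoeff : ∀ k, PowerSeries.coeff k (taylorSeries fun x => F (x, e)) =
      q k fun _ => (1, 0) := by
    intro k
    have hps : HasFPowerSeriesAt (fun x => F (x, e))
        (FormalMultilinearSeries.ofScalars ℝ fun k => q k fun _ => (1, 0)) 0 := by
      rw [hasFPowerSeriesAt_iff]
      have : ∀ᶠ x : ℝ in 𝓝 0, |x| < ρ := by
        have := Metric.ball_mem_nhds (0 : ℝ) (ε := ρ) (by exact_mod_cast hρ0)
        filter_upwards [this] with x hx
        simpa using hx
      filter_upwards [this] with x hx
      simpa [FormalMultilinearSeries.coeff_ofScalars, mul_comm] using hsumq x hx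
    have h2 := hps.analyticAt.hasFPowerSeriesAt.eq_formalMultilinearSeries hps
    have h3 := congrArg (fun s => FormalMultilinearSeries.coeff s k) h2
    simpa [FormalMultilinearSeries.coeff_ofScalars, coeff_taylorSeries] using h3
  refine ⟨hcoeff, fun x hx => ?_⟩
  simp only [hcoeff]
  exact hsumq x hx

end Taylor

section Implicit

open scoped NNReal ENNReal Topology ContDiff

/-- If `F(·, e)` vanishes at `e = 0`, its Taylor coefficients are dominated by a geometric sequence
with a fixed ratio and a factor that tends to `0` with `e`. -/
theorem exists_taylor_bound {E : Type*} [NormedAddCommGroup E] [NormedSpace ℝ E]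
    {F : ℝ × E → ℝ} (hF : AnalyticAt ℝ F 0) (h0 : ∀ᶠ x : ℝ in 𝓝 0, F (x, 0) = 0) :
    ∃ ρ > 0, ∃ B > 0, ∀ C > 0, ∀ᶠ e : E in 𝓝 0,
      (∀ k, |PowerSeries.coeff k (taylorSeries fun x => F (x, e))| ≤ C * B ^ k) ∧
      ∀ x : ℝ, |x| < ρ →
        HasSum (fun k => PowerSeries.coeff k (taylorSeries fun x => F (x, e)) * x ^ k)
          (F (x, e)) := by
  obtain ⟨p, r, hp⟩ := hF
  obtain ⟨ρ, hρ0, hρ⟩ : ∃ ρ : ℝ≥0, 0 < ρ ∧ (ρ : ℝ≥0∞) + ρ < r := by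
    obtain ⟨s, hs0, hs⟩ := ENNReal.lt_iff_exists_nnreal_btwn.mp hp.r_pos
    refine ⟨s / 2, ?_, ?_⟩
    · have : 0 < s := by exact_mod_cast hs0
      positivity
    · rw [← ENNReal.coe_add, add_halves]
      exact hs
  have hρR : (0 : ℝ) < ρ := by exact_mod_cast hρ0
  have hρp : (ρ : ℝ≥0∞) + ρ < p.radius := hρ.trans_le hp.r_le
  have hρp1 : (ρ : ℝ≥0∞) < p.radius := lt_of_le_of_lt le_self_add hρp
  have hsum := p.changeOriginSeries_summable_aux₁ hρp
  set T := ∑' s : (Σ k l : ℕ, { s : Finset (Fin (k + l)) // s.card = l }),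
    ‖p (s.1 + s.2.1)‖₊ * ρ ^ s.2.1 * ρ ^ s.1 with hT
  have hnear : ∀ᶠ e : E in 𝓝 0, ‖e‖₊ < ρ := by
    filter_upwards [Metric.ball_mem_nhds (0 : E) hρR] with e he
    rw [← NNReal.coe_lt_coe]
    simpa using he
  have hbound : ∀ e : E, ‖e‖₊ < ρ → ∀ k,
      |PowerSeries.coeff k (taylorSeries fun x => F (x, e))| ≤ T * (1 / ρ : ℝ) ^ k := by
    intro e he k
    have hnorm : ‖((0, e) : ℝ × E)‖₊ = ‖e‖₊ := by
      rw [Prod.nnnorm_def]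
      simp
    have h1 : ‖p.changeOrigin (0, e) k‖₊ * ρ ^ k ≤ T := by
      have hlt : (‖((0, e) : ℝ × E)‖₊ : ℝ≥0∞) < p.radius := by
        rw [hnorm]
        exact (ENNReal.coe_lt_coe.mpr he).trans hρp1
      have hfib : Summable fun s : (Σ l : ℕ, { s : Finset (Fin (k + l)) // s.card = l }) =>
          ‖p (k + s.1)‖₊ * ρ ^ s.1 := p.changeOriginSeries_summable_aux₂ hρp1 k
      calc ‖p.changeOrigin (0, e) k‖₊ * ρ ^ k
          ≤ (∑' s : (Σ l : ℕ, { s : Finset (Fin (k + l)) // s.card = l }),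
              ‖p (k + s.1)‖₊ * ‖((0, e) : ℝ × E)‖₊ ^ s.1) * ρ ^ k := by
            gcongr
            exact p.nnnorm_changeOrigin_le k hlt
        _ ≤ (∑' s : (Σ l : ℕ, { s : Finset (Fin (k + l)) // s.card = l }),
              ‖p (k + s.1)‖₊ * ρ ^ s.1) * ρ ^ k := by
            refine mul_le_mul_left ?_ _
            refine Summable.tsum_le_tsum (fun s => ?_) (p.changeOriginSeries_summable_aux₂ hlt k)
              hfib
            gcongr
            rw [hnorm]
            exact he.le
        _ = ∑' s : (Σ l : ℕ, { s : Finset (Fin (k + l)) // s.card = l }),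
              ‖p (k + s.1)‖₊ * ρ ^ s.1 * ρ ^ k := by rw [NNReal.tsum_mul_right]
        _ ≤ T := by
            rw [hT, hsum.tsum_sigma' (fun k => (NNReal.summable_sigma.1 hsum).1 k)]
            exact (NNReal.summable_sigma.1 hsum).2.le_tsum' k
    have h2 : |PowerSeries.coeff k (taylorSeries fun x => F (x, e))| ≤
        ‖p.changeOrigin (0, e) k‖ := by
      rw [(hasSum_taylorSeries_of_hasFPowerSeriesOnBall hp hρ0 hρ he).1 k]
      have h := (p.changeOrigin (0, e) k).le_opNorm fun _ => (1, 0)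
      simpa [Prod.norm_def] using h
    have h3 : ‖p.changeOrigin (0, e) k‖ * (ρ : ℝ) ^ k ≤ T := by exact_mod_cast h1
    refine h2.trans ?_
    rw [one_div, inv_pow, ← div_eq_mul_inv, le_div_iff₀ (by positivity)]
    exact h3
  have hcoeff0 : ∀ k, PowerSeries.coeff k (taylorSeries fun x => F (x, 0)) = 0 := by
    intro k
    have h1 : (fun x => F (x, 0)) =ᶠ[𝓝 0] fun _ => (0 : ℝ) := h0
    rw [coeff_taylorSeries, (h1.iteratedDeriv k).eq_of_nhds]
    simp
  have htend : ∀ k, Filter.Tendsto (fun e : E => PowerSeries.coeff k (taylorSeries fun x => F (x, e)))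
      (𝓝 0) (𝓝 0) := by
    intro k
    have h1 : ContinuousAt (fun e : E => p.changeOrigin ((0, e) : ℝ × E) k fun _ => (1, 0)) 0 := by
      have h2 : ContinuousAt (fun z => p.changeOrigin z k) ((0, 0) : ℝ × E) :=
        (p.hasFPowerSeriesOnBall_changeOrigin k (lt_of_le_of_lt bot_le hρp1)).continuousOn.continuousAt
          (Metric.eball_mem_nhds _ (lt_of_le_of_lt bot_le hρp1))
      have h3 : ContinuousAt (fun e : E => p.changeOrigin ((0, e) : ℝ × E) k) 0 :=
        ContinuousAt.comp (f := fun e : E => ((0, e) : ℝ × E)) h2 (by fun_prop)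
      exact (ContinuousMultilinearMap.apply ℝ (fun _ : Fin k => ℝ × E) ℝ
        fun _ => (1, 0)).continuous.continuousAt.comp h3
    have h4 : (fun e : E => PowerSeries.coeff k (taylorSeries fun x => F (x, e))) =ᶠ[𝓝 0]
        fun e : E => p.changeOrigin ((0, e) : ℝ × E) k fun _ => (1, 0) := by
      filter_upwards [hnear] with e he
      exact (hasSum_taylorSeries_of_hasFPowerSeriesOnBall hp hρ0 hρ he).1 k
    have h5 := h1.tendsto.congr' h4.symm
    rwa [← h4.eq_of_nhds, hcoeff0 k] at h5
  refine ⟨ρ, hρR, 2 / ρ, by positivity, fun C hC => ?_⟩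
  obtain ⟨N, hN⟩ : ∃ N : ℕ, (T : ℝ) * (1 / 2) ^ N ≤ C := by
    have h1 : Filter.Tendsto (fun N : ℕ => (T : ℝ) * (1 / 2) ^ N) Filter.atTop (𝓝 (T * 0)) :=
      (tendsto_pow_atTop_nhds_zero_of_lt_one (by norm_num) (by norm_num)).const_mul _
    rw [mul_zero] at h1
    exact ((h1.eventually_lt_const hC).exists).imp fun N hN => hN.le
  have hsmall : ∀ᶠ e : E in 𝓝 0, ∀ k ∈ Finset.range N,
      |PowerSeries.coeff k (taylorSeries fun x => F (x, e))| ≤ C * (2 / ρ : ℝ) ^ k := by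
    rw [Filter.eventually_all_finset]
    intro k _
    have h1 := (htend k).abs
    rw [abs_zero] at h1
    filter_upwards [h1.eventually_lt_const (show 0 < C * (2 / ρ : ℝ) ^ k by positivity)] with e he
    exact he.le
  filter_upwards [hnear, hsmall] with e he hs
  refine ⟨fun k => ?_, (hasSum_taylorSeries_of_hasFPowerSeriesOnBall hp hρ0 hρ he).2⟩
  rcases lt_or_ge k N with hk | hk
  · exact hs k (Finset.mem_range.mpr hk)
  · refine (hbound e he k).trans ?_
    have h1 : (T : ℝ) * (1 / 2) ^ k ≤ C := le_trans
      (mul_le_mul_of_nonneg_left (pow_le_pow_of_le_one (by norm_num) (by norm_num) hk) T.2) hN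
    calc (T : ℝ) * (1 / ρ : ℝ) ^ k = T * (1 / 2) ^ k * (2 / ρ : ℝ) ^ k := by
          rw [mul_assoc, ← mul_pow]
          congr 2
          field_simp
      _ ≤ _ := mul_le_mul_of_nonneg_right h1 (by positivity)

/-- The equation `x = F(x, e)` with `F(x, 0) = 0` is solved uniquely by an analytic function. -/
theorem exists_analytic_fixed_point {E : Type*} [NormedAddCommGroup E] [NormedSpace ℝ E]
    [CompleteSpace E] {F : ℝ × E → ℝ} (hF : AnalyticAt ℝ F 0)
    (h0 : ∀ᶠ x : ℝ in 𝓝 0, F (x, 0) = 0) :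
    ∃ g : E → ℝ, AnalyticAt ℝ g 0 ∧ g 0 = 0 ∧
      ∀ᶠ z : ℝ × E in 𝓝 0, z.1 = F z ↔ z.1 = g z.2 := by
  set H : E × ℝ → ℝ := fun v => v.2 - F (v.2, v.1) with hH
  have hHa : ContDiffAt ℝ ω H (0, 0) := by
    have h1 : AnalyticAt ℝ (fun v : E × ℝ => F (v.2, v.1)) (0, 0) :=
      AnalyticAt.fun_comp (f := fun v : E × ℝ => (v.2, v.1)) hF
        (analyticAt_snd.prod analyticAt_fst)
    exact (analyticAt_snd.sub h1).contDiffAt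
  have hH0 : H (0, 0) = 0 := by
    have := h0.self_of_nhds
    simp [hH, this]
  have hinr : fderiv ℝ H (0, 0) ∘L .inr ℝ E ℝ = ContinuousLinearMap.id ℝ ℝ := by
    have h1 : HasFDerivAt (H ∘ ContinuousLinearMap.inr ℝ E ℝ)
        (fderiv ℝ H (0, 0) ∘L .inr ℝ E ℝ) 0 := by
      refine HasFDerivAt.comp (0 : ℝ) ?_ (ContinuousLinearMap.inr ℝ E ℝ).hasFDerivAt
      exact (hHa.differentiableAt (by simp)).hasFDerivAt
    refine h1.unique ((hasFDerivAt_id (𝕜 := ℝ) (0 : ℝ)).congr_of_eventuallyEq ?_)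
    filter_upwards [h0] with x hx
    simp [hH, hx]
  have hinv : (fderiv ℝ H (0, 0) ∘L .inr ℝ E ℝ).IsInvertible := by
    rw [hinr]
    exact ⟨ContinuousLinearEquiv.refl ℝ ℝ, rfl⟩
  have hne : (ω : ℕ∞ω) ≠ 0 := by simp
  refine ⟨hHa.implicitFunction hne hinv, ?_, hHa.implicitFunction_apply_self hne hinv, ?_⟩
  · exact (hHa.contDiffAt_implicitFunction hne hinv).analyticAt
  · have h1 := hHa.eventually_apply_eq_iff_implicitFunction hne hinv
    have h2 : Filter.Tendsto (fun z : ℝ × E => (z.2, z.1)) (𝓝 0) (𝓝 (0, 0)) := by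
      have : ContinuousAt (fun z : ℝ × E => (z.2, z.1)) 0 := by fun_prop
      exact this.tendsto
    filter_upwards [h2.eventually h1] with z hz
    rw [hH0] at hz
    rw [eq_comm (a := z.1) (b := hHa.implicitFunction hne hinv z.2), ← hz, hH]
    exact sub_eq_zero.symm

end Implicit

section Kinematics

open scoped Topology

theorem particleEnergy_pos {m y : ℝ} (hm : 0 < m) (hy : 0 ≤ y) : 0 < particleEnergy m y :=
  Real.sqrt_pos.mpr (by positivity)

theorem particleEnergy_sub {m y t : ℝ} (hm : 0 < m) (hy : 0 ≤ y) (hyt : 0 ≤ y + t) :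
    particleEnergy m y - particleEnergy m (y + t) =
      -t / (particleEnergy m (y + t) + particleEnergy m y) := by
  have h1 := particleEnergy_pos hm hy
  have h2 := particleEnergy_pos hm hyt
  rw [eq_div_iff (by positivity)]
  have e1 : particleEnergy m y ^ 2 = y + m ^ 2 := Real.sq_sqrt (by positivity)
  have e2 : particleEnergy m (y + t) ^ 2 = y + t + m ^ 2 := Real.sq_sqrt (by positivity)
  linear_combination e1 - e2

theorem hasDerivAt_particleEnergy {m y : ℝ} (hm : 0 < m) (hy : 0 ≤ y) :
    HasDerivAt (fun t => particleEnergy m (y + t)) (1 / (2 * particleEnergy m y)) 0 := by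
  have h : HasDerivAt (fun t : ℝ => y + t + m ^ 2) 1 0 :=
    ((hasDerivAt_id (0 : ℝ)).const_add y).add_const _
  have h2 := h.sqrt (by rw [add_zero]; positivity)
  simpa only [particleEnergy, add_zero] using h2

theorem analyticAt_particleEnergy {m y : ℝ} (hm : 0 < m) (hy : 0 ≤ y) :
    AnalyticAt ℝ (fun t => particleEnergy m (y + t)) 0 := by
  have h : ContDiffAt ℝ ⊤ (fun t : ℝ => y + t + m ^ 2) 0 := by fun_prop
  exact (h.sqrt (by rw [add_zero]; positivity)).analyticAt

/-- The reduced propagator without the removable singularity. -/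
theorem reducedPropagator_eq_closed {m₁ m₂ y : ℝ} (hm₁ : 0 < m₁) (hm₂ : 0 < m₂) (hy : 0 ≤ y) {t : ℝ}
    (hyt : 0 ≤ y + t) :
    reducedPropagator m₁ m₂ y t =
      (-(particleEnergy m₁ (y + t) + particleEnergy m₁ y)⁻¹ -
        (particleEnergy m₂ (y + t) + particleEnergy m₂ y)⁻¹)⁻¹ := by
  have h1 := particleEnergy_pos hm₁ hy
  have h2 := particleEnergy_pos hm₂ hy
  rw [reducedPropagator]
  congr 1
  by_cases ht : t = 0
  · subst ht
    rw [dslope_same]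
    have h : HasDerivAt (fun t => kineticEnergy m₁ m₂ y - kineticEnergy m₁ m₂ (y + t))
        (-(1 / (2 * particleEnergy m₁ y) + 1 / (2 * particleEnergy m₂ y))) 0 :=
      ((hasDerivAt_particleEnergy hm₁ hy).add (hasDerivAt_particleEnergy hm₂ hy)).const_sub _
    rw [h.deriv, add_zero]
    field_simp
    ring
  · rw [dslope_of_ne _ ht, slope_def_field, add_zero, sub_self, sub_zero, sub_zero]
    have e : kineticEnergy m₁ m₂ y - kineticEnergy m₁ m₂ (y + t) =
        (particleEnergy m₁ y - particleEnergy m₁ (y + t)) +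
          (particleEnergy m₂ y - particleEnergy m₂ (y + t)) := by
      simp only [kineticEnergy]
      ring
    rw [e, particleEnergy_sub hm₁ hy hyt, particleEnergy_sub hm₂ hy hyt]
    have h3 := particleEnergy_pos hm₁ hyt
    have h4 := particleEnergy_pos hm₂ hyt
    field_simp
    ring

theorem reducedPropagator_ne_zero {m₁ m₂ y : ℝ} (hm₁ : 0 < m₁) (hm₂ : 0 < m₂)
    (hy : 0 < y) {t : ℝ} (hyt : 0 ≤ y + t) :
    reducedPropagator m₁ m₂ y t ≠ 0 := by
  rw [reducedPropagator_eq_closed hm₁ hm₂ hy.le hyt]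
  have h1 := particleEnergy_pos hm₁ hy.le
  have h2 := particleEnergy_pos hm₂ hy.le
  have h3 := particleEnergy_pos hm₁ hyt
  have h4 := particleEnergy_pos hm₂ hyt
  refine inv_ne_zero (ne_of_lt ?_)
  have h5 : 0 < (particleEnergy m₁ (y + t) + particleEnergy m₁ y)⁻¹ := by positivity
  have h6 : 0 < (particleEnergy m₂ (y + t) + particleEnergy m₂ y)⁻¹ := by positivity
  linarith

theorem reducedPropagator_mul {m₁ m₂ y : ℝ} (hm₁ : 0 < m₁) (hm₂ : 0 < m₂)
    (hy : 0 < y) {t : ℝ} (hyt : 0 ≤ y + t) :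
    reducedPropagator m₁ m₂ y t * (kineticEnergy m₁ m₂ y - kineticEnergy m₁ m₂ (y + t)) = t := by
  have hK := reducedPropagator_ne_zero hm₁ hm₂ hy hyt
  rw [reducedPropagator] at hK ⊢
  have h := sub_smul_dslope
    (fun t => kineticEnergy m₁ m₂ y - kineticEnergy m₁ m₂ (y + t)) 0 t
  simp only [sub_zero, smul_eq_mul, add_zero, sub_self] at h
  rw [← h, mul_left_comm, inv_mul_cancel₀ (fun h0 => hK (by rw [h0, inv_zero])), mul_one]

theorem eventually_reducedPropagator_eq_closed {m₁ m₂ y : ℝ} (hm₁ : 0 < m₁) (hm₂ : 0 < m₂)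
    (hy : 0 < y) :
    reducedPropagator m₁ m₂ y =ᶠ[𝓝 0] fun t =>
      (-(particleEnergy m₁ (y + t) + particleEnergy m₁ y)⁻¹ -
        (particleEnergy m₂ (y + t) + particleEnergy m₂ y)⁻¹)⁻¹ := by
  filter_upwards [lt_mem_nhds (show -y < 0 by linarith)] with t ht
  exact reducedPropagator_eq_closed hm₁ hm₂ hy.le (by linarith)

theorem analyticAt_reducedPropagator {m₁ m₂ y : ℝ} (hm₁ : 0 < m₁) (hm₂ : 0 < m₂)
    (hy : 0 < y) : AnalyticAt ℝ (reducedPropagator m₁ m₂ y) 0 := by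
  refine AnalyticAt.congr ?_ (eventually_reducedPropagator_eq_closed hm₁ hm₂ hy).symm
  have h1 := particleEnergy_pos hm₁ hy.le
  have h2 := particleEnergy_pos hm₂ hy.le
  have a1 : AnalyticAt ℝ (fun t => (particleEnergy m₁ (y + t) + particleEnergy m₁ y)⁻¹) 0 :=
    ((analyticAt_particleEnergy hm₁ hy.le).add analyticAt_const).inv (by
      simp only [Pi.add_apply, add_zero]; positivity)
  have a2 : AnalyticAt ℝ (fun t => (particleEnergy m₂ (y + t) + particleEnergy m₂ y)⁻¹) 0 :=
    ((analyticAt_particleEnergy hm₂ hy.le).add analyticAt_const).inv (by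
      simp only [Pi.add_apply, add_zero]; positivity)
  refine (a1.neg.sub a2).inv (ne_of_lt ?_)
  simp only [Pi.sub_apply, Pi.neg_apply, add_zero]
  have h5 : 0 < (particleEnergy m₁ y + particleEnergy m₁ y)⁻¹ := by positivity
  have h6 : 0 < (particleEnergy m₂ y + particleEnergy m₂ y)⁻¹ := by positivity
  linarith

theorem reducedPropagator_zero {m₁ m₂ y : ℝ} (hm₁ : 0 < m₁) (hm₂ : 0 < m₂)
    (hy : 0 < y) : reducedPropagator m₁ m₂ y 0 =
    -(2 * (particleEnergy m₁ y * particleEnergy m₂ y /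
      (particleEnergy m₁ y + particleEnergy m₂ y))) := by
  rw [reducedPropagator_eq_closed hm₁ hm₂ hy.le (by linarith), add_zero]
  have h1 := particleEnergy_pos hm₁ hy.le
  have h2 := particleEnergy_pos hm₂ hy.le
  have e : -(particleEnergy m₁ y + particleEnergy m₁ y)⁻¹ -
      (particleEnergy m₂ y + particleEnergy m₂ y)⁻¹ =
      -((particleEnergy m₁ y + particleEnergy m₂ y) /
        (2 * (particleEnergy m₁ y * particleEnergy m₂ y))) := by
    field_simp
    ring
  rw [e, inv_neg, inv_div]
  ring

theorem deriv_reducedPropagator_zero {m₁ m₂ y : ℝ} (hm₁ : 0 < m₁) (hm₂ : 0 < m₂)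
    (hy : 0 < y) : deriv (reducedPropagator m₁ m₂ y) 0 =
    -((particleEnergy m₁ y ^ 2 - particleEnergy m₁ y * particleEnergy m₂ y +
        particleEnergy m₂ y ^ 2) /
      (2 * (particleEnergy m₁ y ^ 2 * particleEnergy m₂ y +
        particleEnergy m₁ y * particleEnergy m₂ y ^ 2))) := by
  rw [(eventually_reducedPropagator_eq_closed hm₁ hm₂ hy).deriv_eq]
  have h1 := particleEnergy_pos hm₁ hy.le
  have h2 := particleEnergy_pos hm₂ hy.le
  have d1 := ((hasDerivAt_particleEnergy hm₁ hy.le).add_const (particleEnergy m₁ y)).fun_inv (by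
    simp only [add_zero]; positivity)
  have d2 := ((hasDerivAt_particleEnergy hm₂ hy.le).add_const (particleEnergy m₂ y)).fun_inv (by
    simp only [add_zero]; positivity)
  have hne : -(particleEnergy m₁ (y + 0) + particleEnergy m₁ y)⁻¹ -
      (particleEnergy m₂ (y + 0) + particleEnergy m₂ y)⁻¹ ≠ 0 := by
    rw [add_zero]
    refine ne_of_lt ?_
    have h5 : 0 < (particleEnergy m₁ y + particleEnergy m₁ y)⁻¹ := by positivity
    have h6 : 0 < (particleEnergy m₂ y + particleEnergy m₂ y)⁻¹ := by positivity
    linarith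
  rw [((d1.fun_neg.fun_sub d2).fun_inv hne).deriv]
  simp only [add_zero]
  have e : -(particleEnergy m₁ y + particleEnergy m₁ y)⁻¹ -
      (particleEnergy m₂ y + particleEnergy m₂ y)⁻¹ =
      -((particleEnergy m₁ y + particleEnergy m₂ y) /
        (2 * (particleEnergy m₁ y * particleEnergy m₂ y))) := by
    field_simp
    ring
  rw [e]
  field_simp
  ring

/-- The kinematics of the centre-of-mass frame at infinite separation. -/
theorem pInfSq_kinematics {E m₁ m₂ : ℝ} (hm₁ : 0 < m₁) (hm₂ : 0 < m₂) (hE : m₁ + m₂ < E) :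
    0 < pInfSq E m₁ m₂ ∧
      particleEnergy m₁ (pInfSq E m₁ m₂) + particleEnergy m₂ (pInfSq E m₁ m₂) = E := by
  have hE0 : 0 < E := by linarith
  constructor
  · rw [pInfSq]
    refine div_pos ?_ (by positivity)
    have e : (E ^ 2 - m₁ ^ 2 - m₂ ^ 2) ^ 2 - 4 * m₁ ^ 2 * m₂ ^ 2 =
        (E - (m₁ + m₂)) * (E + (m₁ + m₂)) * ((E - m₁ + m₂) * (E + m₁ - m₂)) := by ring
    rw [e]
    have h1 : 0 < E - (m₁ + m₂) := by linarith
    have h2 : 0 < E - m₁ + m₂ := by linarith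
    have h3 : 0 < E + m₁ - m₂ := by linarith
    positivity
  · have e1 : particleEnergy m₁ (pInfSq E m₁ m₂) = (E ^ 2 + m₁ ^ 2 - m₂ ^ 2) / (2 * E) := by
      rw [particleEnergy, show pInfSq E m₁ m₂ + m₁ ^ 2 =
        ((E ^ 2 + m₁ ^ 2 - m₂ ^ 2) / (2 * E)) ^ 2 by rw [pInfSq]; field_simp; ring]
      refine Real.sqrt_sq (div_nonneg ?_ (by positivity))
      nlinarith
    have e2 : particleEnergy m₂ (pInfSq E m₁ m₂) = (E ^ 2 + m₂ ^ 2 - m₁ ^ 2) / (2 * E) := by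
      rw [particleEnergy, show pInfSq E m₁ m₂ + m₂ ^ 2 =
        ((E ^ 2 + m₂ ^ 2 - m₁ ^ 2) / (2 * E)) ^ 2 by rw [pInfSq]; field_simp; ring]
      refine Real.sqrt_sq (div_nonneg ?_ (by positivity))
      nlinarith
    rw [e1, e2]
    field_simp
    ring

end Kinematics

section Main

open scoped Topology

theorem doubleSeries_zero {c : ℕ → ℕ → ℝ → ℝ} (hc : ∀ p, c 0 0 p = 0) (p : ℝ) :
    doubleSeries c p 0 0 = 0 := by
  rw [doubleSeries, tsum_congr (g := fun _ => (0 : ℝ)), tsum_zero]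
  rintro ⟨i, j⟩
  rcases i with _ | i
  · rcases j with _ | j
    · simp [hc]
    · simp
  · simp

/-- The potential as a function of the shift of the squared momentum and of the two couplings. -/
noncomputable def shiftedPotential (c : ℕ → ℕ → ℝ → ℝ) (y : ℝ) (z : ℝ × ℝ × ℝ) : ℝ :=
  doubleSeries c (Real.sqrt (y + z.1)) z.2.1 z.2.2

theorem analyticAt_shiftedPotential {c : ℕ → ℕ → ℝ → ℝ} {y : ℝ} (hy : 0 < y)
    (hV : AnalyticAt ℝ (fun z : ℝ × ℝ × ℝ => doubleSeries c z.1 z.2.1 z.2.2)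
      (Real.sqrt y, 0, 0)) : AnalyticAt ℝ (shiftedPotential c y) 0 := by
  have h1 : AnalyticAt ℝ (fun z : ℝ × ℝ × ℝ => (Real.sqrt (y + z.1), z.2)) 0 := by
    have h : ContDiffAt ℝ ⊤ (fun z : ℝ × ℝ × ℝ => y + z.1) 0 := by fun_prop
    have h2 : ContDiffAt ℝ ⊤ (fun z : ℝ × ℝ × ℝ => (Real.sqrt (y + z.1), z.2)) 0 :=
      (h.sqrt (by simpa using hy.ne')).prodMk contDiffAt_snd
    exact h2.analyticAt
  refine AnalyticAt.fun_comp (g := fun z : ℝ × ℝ × ℝ => doubleSeries c z.1 z.2.1 z.2.2)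
    (f := fun z : ℝ × ℝ × ℝ => (Real.sqrt (y + z.1), z.2)) ?_ h1
  change AnalyticAt ℝ _ (Real.sqrt (y + 0), 0, 0)
  rwa [add_zero]

/-- The coefficients of the Lagrange series are the classical parts of the iterations. -/
theorem classicalPart_eq_lagrange {m₁ m₂ y : ℝ} (hm₁ : 0 < m₁) (hm₂ : 0 < m₂) (hy : 0 < y)
    {U : ℝ → ℝ} {Y : PowerSeries ℝ}
    (hY : ∀ n m : ℕ, ((n : ℝ) + m) * PowerSeries.coeff n (Y ^ m) = m * PowerSeries.coeff n
      ((taylorSeries (reducedPropagator m₁ m₂ y) * taylorSeries fun x => U (y + x)) ^ (n + m)))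
    (n : ℕ) :
    classicalPart n (bornNumerator m₁ m₂ y U n) =
      (reducedPropagator m₁ m₂ y 0)⁻¹ * PowerSeries.coeff n Y := by
  have hK := reducedPropagator_ne_zero (t := 0) hm₁ hm₂ hy (by linarith)
  have h1 := classicalPart_bornNumerator m₁ m₂ y U n
  have h2 := hY n 1
  rw [pow_one, Nat.cast_one, one_mul, ← h1] at h2
  have h3 := mul_left_cancel₀ (show ((n : ℝ) + 1) ≠ 0 by positivity) h2
  rw [h3, inv_mul_cancel_left₀ hK]

theorem classicalPart_bornNumerator_zero {m₁ m₂ y : ℝ} (hm₁ : 0 < m₁) (hm₂ : 0 < m₂) (hy : 0 < y)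
    (U : ℝ → ℝ) : classicalPart 0 (bornNumerator m₁ m₂ y U 0) = U y := by
  have hK := reducedPropagator_ne_zero (t := 0) hm₁ hm₂ hy (by linarith)
  have h := classicalPart_bornNumerator m₁ m₂ y U 0
  rw [zero_add, pow_one, PowerSeries.coeff_mul, Finset.HasAntidiagonal.antidiagonal_zero,
    Finset.sum_singleton, coeff_taylorSeries, coeff_taylorSeries] at h
  simp only [Nat.cast_zero, zero_add, one_mul, iteratedDeriv_zero, Nat.factorial_zero, Nat.cast_one,
    div_one, add_zero] at h
  exact mul_left_cancel₀ hK h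

theorem classicalPart_bornNumerator_one {m₁ m₂ y : ℝ} (hm₁ : 0 < m₁) (hm₂ : 0 < m₂) (hy : 0 < y)
    (U : ℝ → ℝ) : classicalPart 1 (bornNumerator m₁ m₂ y U 1) =
      reducedPropagator m₁ m₂ y 0 * U y * deriv U y +
        deriv (reducedPropagator m₁ m₂ y) 0 * U y ^ 2 := by
  have hK := reducedPropagator_ne_zero (t := 0) hm₁ hm₂ hy (by linarith)
  have h := classicalPart_bornNumerator m₁ m₂ y U 1
  have hc : ∀ p q : PowerSeries ℝ, PowerSeries.coeff 1 (p * q) =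
      PowerSeries.coeff 0 p * PowerSeries.coeff 1 q +
        PowerSeries.coeff 1 p * PowerSeries.coeff 0 q := fun p q => by
    rw [PowerSeries.coeff_mul, Finset.Nat.antidiagonal_succ]
    simp
  have hc0 : ∀ p q : PowerSeries ℝ, PowerSeries.coeff 0 (p * q) =
      PowerSeries.coeff 0 p * PowerSeries.coeff 0 q := fun p q => by simp
  rw [pow_succ, pow_one, hc, hc0, hc] at h
  simp only [coeff_taylorSeries, iteratedDeriv_zero, iteratedDeriv_one, Nat.factorial_zero,
    Nat.factorial_one, Nat.cast_one, div_one, add_zero, deriv_comp_const_add] at h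
  refine mul_left_cancel₀ (mul_ne_zero (two_ne_zero (α := ℝ)) hK) ?_
  linear_combination h

end Main

theorem mainTheorem1 (E m₁ m₂ : ℝ) (hm₁ : 0 < m₁) (hm₂ : 0 < m₂) (hE : m₁ + m₂ < E)
    (c : ℕ → ℕ → ℝ → ℝ)
    (hc : ∀ p, c 0 0 p = 0)
    (hsum : ∀ᶠ z : ℝ × ℝ × ℝ in nhds (Real.sqrt (pInfSq E m₁ m₂), 0, 0),
      Summable fun k : ℕ × ℕ => c k.1 k.2 z.1 * z.2.1 ^ k.1 * z.2.2 ^ k.2)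
    (hV : AnalyticAt ℝ (fun z : ℝ × ℝ × ℝ => doubleSeries c z.1 z.2.1 z.2.2)
      (Real.sqrt (pInfSq E m₁ m₂), 0, 0)) :
    0 < pInfSq E m₁ m₂ ∧
    ∃ ε > 0, ∃ δ > 0, ∃ g : ℝ × ℝ → ℝ,
      AnalyticOnNhd ℝ g (Metric.ball 0 ε) ∧ g (0, 0) = pInfSq E m₁ m₂ ∧
      ∀ r r₁ r₂ : ℝ, 0 < r → |r₁ / r| < ε → |r₂ / r| < ε →
        -- `|p|² = g (r₁/r, r₂/r)` is the unique solution of the energy condition near `|p_∞|²`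
        |g (r₁ / r, r₂ / r) - pInfSq E m₁ m₂| < δ ∧
        (∀ y : ℝ, |y - pInfSq E m₁ m₂| < δ →
          (EnergyCondition E m₁ m₂ c r₁ r₂ r y ↔ y = g (r₁ / r, r₂ / r))) ∧
        -- the iterated Lippmann–Schwinger series for the classical amplitude converges
        Summable (classicalBornTerm m₁ m₂ (pInfSq E m₁ m₂) c r₁ r₂ r) ∧
        -- its first two terms
        (let E₁ := particleEnergy m₁ (pInfSq E m₁ m₂)
         let E₂ := particleEnergy m₂ (pInfSq E m₁ m₂)
         let V : ℝ → ℝ := fun y => potential c r₁ r₂ (Real.sqrt y) r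
         classicalBornTerm m₁ m₂ (pInfSq E m₁ m₂) c r₁ r₂ r 0 = V (pInfSq E m₁ m₂) ∧
         classicalBornTerm m₁ m₂ (pInfSq E m₁ m₂) c r₁ r₂ r 1 =
           -(2 * (E₁ * E₂ / E) * V (pInfSq E m₁ m₂) * deriv V (pInfSq E m₁ m₂)) -
             (E₁ ^ 2 - E₁ * E₂ + E₂ ^ 2) / (2 * (E₁ ^ 2 * E₂ + E₁ * E₂ ^ 2)) *
               V (pInfSq E m₁ m₂) ^ 2) ∧
        -- the relation between momentum and classical amplitude
        g (r₁ / r, r₂ / r) =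
          pInfSq E m₁ m₂ -
            classicalAmplitude m₁ m₂ (pInfSq E m₁ m₂) c r₁ r₂ r / (2 * E) := by
  obtain ⟨hy, hkin⟩ := pInfSq_kinematics hm₁ hm₂ hE
  have hE0 : 0 < E := by linarith
  set y₀ := pInfSq E m₁ m₂ with hy₀
  have hE₁ := particleEnergy_pos hm₁ hy.le
  have hE₂ := particleEnergy_pos hm₂ hy.le
  set K := reducedPropagator m₁ m₂ y₀ with hK
  have hKa : AnalyticAt ℝ K 0 := analyticAt_reducedPropagator hm₁ hm₂ hy
  have hAa := analyticAt_shiftedPotential hy hV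
  set A := shiftedPotential c y₀ with hA
  have hA0 : ∀ x, A (x, 0) = 0 := fun x => doubleSeries_zero hc _
  set F : ℝ × ℝ × ℝ → ℝ := fun z => K z.1 * A z with hF
  have hFa : AnalyticAt ℝ F 0 := (hKa.comp_of_eq analyticAt_fst rfl).mul hAa
  have hF0 : ∀ᶠ x : ℝ in nhds 0, F (x, 0) = 0 :=
    Filter.Eventually.of_forall fun x => by simp only [hF, hA0, mul_zero]
  obtain ⟨g, hga, hg0, hg⟩ := exists_analytic_fixed_point hFa hF0
  obtain ⟨ρ, hρ, B, hB, hbound⟩ := exists_taylor_bound hFa hF0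
  obtain ⟨η, hη, hgη⟩ := Metric.eventually_nhds_iff_ball.mp hg
  set δ := min (min η ρ) y₀ with hδ
  have hδ0 : 0 < δ := lt_min (lt_min hη hρ) hy
  have hδη : δ ≤ η := (min_le_left _ _).trans (min_le_left _ _)
  have hδρ : δ ≤ ρ := (min_le_left _ _).trans (min_le_right _ _)
  have hδy : δ ≤ y₀ := min_le_right _ _
  set C := min (δ / 8) (1 / (8 * B)) with hC
  have hC0 : 0 < C := lt_min (by positivity) (by positivity)
  have hCδ : 4 * C < δ := by
    have : C ≤ δ / 8 := min_le_left _ _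
    linarith
  have hCB : 4 * C * B ≤ 1 / 2 := by
    have h1 : C ≤ 1 / (8 * B) := min_le_right _ _
    rw [le_div_iff₀ (by positivity)] at h1
    linarith
  have hgδ : ∀ᶠ e : ℝ × ℝ in nhds 0, |g e| < δ := by
    have h1 := hga.continuousAt.abs.tendsto
    rw [hg0, abs_zero] at h1
    exact h1.eventually_lt_const hδ0
  have hAe : ∀ᶠ e : ℝ × ℝ in nhds 0, AnalyticAt ℝ (fun x => A (x, e)) 0 := by
    have h1 : Filter.Tendsto (fun e : ℝ × ℝ => ((0, e) : ℝ × ℝ × ℝ)) (nhds 0) (nhds 0) := by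
      have : ContinuousAt (fun e : ℝ × ℝ => ((0, e) : ℝ × ℝ × ℝ)) 0 := by fun_prop
      exact this.tendsto
    filter_upwards [h1.eventually hAa.eventually_analyticAt] with e he
    exact AnalyticAt.fun_comp (f := fun x : ℝ => (x, e)) he (analyticAt_id.prod analyticAt_const)
  obtain ⟨ε', hε', hall⟩ := Metric.eventually_nhds_iff_ball.mp
    (hga.eventually_analyticAt.and (hgδ.and (hAe.and (hbound C hC0))))
  refine ⟨hy, min ε' η, lt_min hε' hη, δ, hδ0, fun e => y₀ + g e, ?_, ?_, ?_⟩
  · intro e he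
    exact analyticAt_const.add
      (hall e (Metric.ball_subset_ball (min_le_left _ _) he)).1
  · change y₀ + g 0 = y₀
    rw [hg0, add_zero]
  intro r r₁ r₂ _ h₁ h₂
  set e : ℝ × ℝ := (r₁ / r, r₂ / r) with he
  have hnorm : ‖e‖ < min ε' η := by
    rw [Prod.norm_def]
    exact max_lt h₁ h₂
  obtain ⟨-, hge, hAea, hcoeff, hFsum⟩ :=
    hall e (by rw [mem_ball_zero_iff]; exact hnorm.trans_le (min_le_left _ _))
  have hsol : ∀ x : ℝ, |x| < δ → (x = F (x, e) ↔ x = g e) := by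
    intro x hx
    refine hgη (x, e) ?_
    rw [mem_ball_zero_iff, Prod.norm_def]
    exact max_lt (hx.trans_le hδη) (hnorm.trans_le (min_le_right _ _))
  have hpot : ∀ x, potential c r₁ r₂ (Real.sqrt (y₀ + x)) r = A (x, e) := fun x => rfl
  have hTF : (taylorSeries fun x => F (x, e)) =
      taylorSeries K * taylorSeries fun x => A (x, e) := taylorSeries_mul hKa hAea
  obtain ⟨Y, hY⟩ := exists_lagrange (taylorSeries fun x => F (x, e))
  obtain ⟨hYsum, hYabs, hYfix⟩ := lagrange_hasSum hC0.le hB.le hcoeff hCB hY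
  set s := ∑' n, PowerSeries.coeff n Y with hs
  have hsδ : |s| < δ := hYabs.trans_lt hCδ
  have hsg : s = g e := (hsol s hsδ).mp
    (hYfix.unique (hFsum s (hsδ.trans_le hδρ)))
  rw [hTF] at hY
  have hterm : ∀ n, classicalBornTerm m₁ m₂ y₀ c r₁ r₂ r n =
      (K 0)⁻¹ * PowerSeries.coeff n Y := fun n =>
    classicalPart_eq_lagrange (U := fun y => potential c r₁ r₂ (Real.sqrt y) r) hm₁ hm₂ hy hY n
  have hK0 : K 0 = -(2 * (particleEnergy m₁ y₀ * particleEnergy m₂ y₀ / E)) := by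
    rw [hK, reducedPropagator_zero hm₁ hm₂ hy, hkin]
  refine ⟨?_, ?_, ?_, ⟨?_, ?_⟩, ?_⟩
  · simpa using hge
  · intro y hyδ
    obtain ⟨x, rfl⟩ : ∃ x, y = y₀ + x := ⟨y - y₀, by ring⟩
    rw [add_sub_cancel_left] at hyδ
    have hx0 : 0 ≤ y₀ + x := by
      have := (abs_lt.mp hyδ).1
      linarith
    have hKx := reducedPropagator_ne_zero hm₁ hm₂ hy hx0
    have hKm := reducedPropagator_mul hm₁ hm₂ hy hx0
    rw [add_right_inj, ← hsol x hyδ, EnergyCondition, hpot]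
    have hkin' : kineticEnergy m₁ m₂ y₀ = E := hkin
    rw [hkin', kineticEnergy] at hKm
    constructor
    · rintro ⟨-, h⟩
      have hA : A (x, e) = E - (particleEnergy m₁ (y₀ + x) + particleEnergy m₂ (y₀ + x)) := by
        linarith
      rw [← hA] at hKm
      exact hKm.symm
    · intro h
      refine ⟨hx0, ?_⟩
      have h' : x = K x * A (x, e) := h
      have := mul_left_cancel₀ hKx (hKm.trans h')
      linarith
  · rw [show classicalBornTerm m₁ m₂ y₀ c r₁ r₂ r = fun n => (K 0)⁻¹ * PowerSeries.coeff n Y from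
      funext hterm]
    exact hYsum.mul_left _
  · exact classicalPart_bornNumerator_zero hm₁ hm₂ hy _
  · rw [classicalBornTerm, classicalPart_bornNumerator_one hm₁ hm₂ hy,
      deriv_reducedPropagator_zero hm₁ hm₂ hy, ← hK, hK0]
    ring
  · change y₀ + g e = _
    rw [classicalAmplitude, tsum_congr hterm, tsum_mul_left, ← hs, hsg, hK0]
    field_simp
    ring
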